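/- **Setting.** Let $k$ be a field. Let $n,r,s,\delta,w$ be integers with $1\le\delta<n$, $2\le r<s$ and $0\le w\le r-1$ (a *signature* $(n,r,s,\delta,w)$). Monomials are in $x_1,\dots,x_n$; inequalities between monomials refer to the lexicographic order with $x_1>x_2>\dots>x_n$; for $1\le i\le n$ let $\mathbb T_i$ be the set of monomials involving only $x_i,\dots,x_n$. Put $b_\ell=x_\delta^{r-w}x_n^w$ and let $\mathcal O$ be the order ideal of signature $(n,r,s,\delta,w)$: it consists of all monomials of degree $<r$, and of those $m\in\mathbb T_\delta$ of degree $d$, $r\le d\le s$, such that $m<x_n^{d-r}b_\ell$. Its elements are the *basis monomials*. The *boundary* $\partial\mathcal O$ consists of the monomials $x_i t\notin\mathcal O$ with $t\in\mathcal O$, $1\le i\le n$. Two boundary monomials $b_1,b_2$ form a *next-door neighbor pair* if $x_\alpha b_1=b_2$ for some variable $x_\alpha$, and an *across-the-street neighbor pair* if $x_\alpha b_1=x_\beta b_2$ for distinct variables $x_\alpha,x_\beta$. Let - $LM$ (*leading monomials*) be the set of monomials $m\ge b_\ell$ of degree $r$, and $TM$ (*trailing monomials*) the set of basis monomials of degree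 $s$; - $\mathcal T''$ be the set of basis monomials of degrees $r$ through $s-1$ that are divisible by $x_{\delta+1}^w$; - $\mathcal S_{(e)}$, for $0\le e\le w$, be the segment of those $m\in\mathbb T_\delta$ of degree $r$ with $x_\delta^{r-e}x_{\delta+1}^e\ge m\ge x_\delta^{r-e}x_n^e$; put $b_{(e)}=x_\delta^{r-e}x_{\delta+1}^e$, its lex-maximal element; - $\mathcal S_L=LM\cap\mathbb T_\delta=\bigcup_{e=0}^w\mathcal S_{(e)}$, and $\mathcal S_D$ be the set of boundary monomials in $\mathbb T_\delta$ of degrees $r+1$ through $s$. Let $D=\{C_{t,b} : t\in TM,\ b\in LM\}$ and $\Theta=\{\theta_t : t\in\mathcal T''\}$ be sets of indeterminates. The *generic distinguished $\mathcal O$-border pre-basis* consists of the polynomials $G_b\in k[D,\Theta][x_1,\dots,x_n]$, $b\in\partial\mathcal O$, where $G_b=b-\sum_{t\in TM}C_{t,b}\,t$ if $b\in LM$ and $G_b=b$ otherwise. **Reduction.** Given a family $F=\{F_b\}_{b\in\partial\mathcal O}$ of polynomials such that every $F_b-b$ is a $k[D,\Theta]$-linear combination of basis monomials (an *$\mathcal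 O$-border pre-basis*), the reduction modulo $F$ of a $k[D,\Theta]$-linear combination $L$ of basis and boundary monomials is obtained from $L$ by replacing each boundary monomial $b$ by $b-F_b$. If the result is $L'$, we write $L\to L'\bmod F$. **Target assignment.** The generic targets $\Upsilon(b)$, $b\in\partial\mathcal O$, are defined as follows. 1. $\Upsilon(b_{(w)})=\sum_{t\in\mathcal T''}\theta_t\,t$. For $0\le e\le w$, a target of $b_{(e)}$ is extended to each element $m=x_\delta^{r-e}x_{\delta+1}^{e-e_1}x_{\delta+2}^{e_1-e_2}\cdots x_n^{e_{n-\delta-1}}$ of $\mathcal S_{(e)}$ by the rule $$\Upsilon(m)=\Bigl(\tfrac{x_n}{x_{n-1}}\Bigr)^{e_{n-\delta-1}}\cdots\Bigl(\tfrac{x_{\delta+3}}{x_{\delta+2}}\Bigr)^{e_2}\Bigl(\tfrac{x_{\delta+2}}{x_{\delta+1}}\Bigr)^{e_1}\Upsilon(b_{(e)}),$$ the multiplications and (exact) divisions being carried out one after the other from right to left. With $e=w$ this gives $\Upsilon$ on $\mathcal S_{(w)}$. 2. Each $b\in\mathcal S_D$ can be written as $b=m'b'$ with $b'\in\mathcal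 S_{(w)}$, $m'\in\mathbb T_{\delta+1}$ and $1\le\deg m'\le s-r$; $\Upsilon(b)$ is $m'\,\Upsilon(b')$ with all terms of degree $>s$ removed (this does not depend on the factorization). 3. For $e=w-1,w-2,\dots,0$ put $\Upsilon(b_{(e)})=\operatorname{red}\bigl(x_\delta\,\Upsilon(b_{(e+1)})\bigr)/x_{\delta+1}$, an exact division, where $\operatorname{red}$ denotes reduction in which each occurring boundary monomial $b$, which always lies in $\mathcal S_D$, is replaced by $-\Upsilon(b)$; then extend to $\mathcal S_{(e)}$ by the rule in 1. For all other boundary monomials, $\Upsilon(b)=0$. The *generic modification* is the family $\hat{\mathcal G}=\{\hat G_b=G_b+\Upsilon(b) : b\in\partial\mathcal O\}$. **Theorem.** For every signature $(n,r,s,\delta,w)$ the following hold. (a) For every next-door or across-the-street neighbor pair $b_1,b_2\in\partial\mathcal O$ with $x_\alpha b_1=x_\beta b_2$ (where $x_\beta=1$ for a next-door pair), the S-polynomial $x_\alpha\hat G_{b_1}-x_\beta\hat G_{b_2}$ is a $k[D,\Theta]$-linear combination of basis and boundary monomials, and $$x_\alpha\hat G_{b_1}-x_\beta\hat G_{b_2}\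 \to\ 0\bmod\hat{\mathcal G}.$$ (b) The quotient $k[D,\Theta][x_1,\dots,x_n]/(\hat{\mathcal G})$ is a free $k[D,\Theta]$-module with basis the residue classes of the elements of $\mathcal O$. Each $\hat G_b-b$ is a linear combination of elements of $\mathcal O$, so $\hat{\mathcal G}$ is an $\mathcal O$-border basis of the ideal $(\hat{\mathcal G})$. -/

import Mathlib

noncomputable section

/-! ### Border bases over a commutative ring

Monomials in `n` variables are exponent vectors `Fin n →₀ ℕ` (written additively), and the polynomial
ring is `MvPolynomial (Fin n) A`. -/

namespace Border

variable {n : ℕ} {A : Type*} [CommRing A]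

/-- The border (boundary) `∂O` of a set of monomials `O`: the products of a variable with an
element of `O` that do not lie in `O`. -/
def boundary (O : Set (Fin n →₀ ℕ)) : Set (Fin n →₀ ℕ) :=
  {b | b ∉ O ∧ ∃ t ∈ O, ∃ i : Fin n, b = t + Finsupp.single i 1}

/-- The family `g` (of which only the members indexed by `∂O` matter) is an `O`-border pre-basis:
each `g b`, `b ∈ ∂O`, is `b` plus a linear combination of monomials in `O`. -/
def IsPrebasis (O : Set (Fin n →₀ ℕ)) (g : (Fin n →₀ ℕ) → MvPolynomial (Fin n) A) : Prop :=
  ∀ b ∈ boundary O, ∀ m ∈ (g b - MvPolynomial.monomial b 1).support, m ∈ O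

/-- The ideal generated by the members of the family `g` that are indexed by `∂O`. -/
def ideal (O : Set (Fin n →₀ ℕ)) (g : (Fin n →₀ ℕ) → MvPolynomial (Fin n) A) :
    Ideal (MvPolynomial (Fin n) A) :=
  Ideal.span (g '' boundary O)

/-- The quotient by the ideal of `g` is a free `A`-module with basis the residue classes of the
monomials in `O`. -/
def IsFreeWithBasis (O : Set (Fin n →₀ ℕ)) (g : (Fin n →₀ ℕ) → MvPolynomial (Fin n) A) : Prop :=
  ∃ B : Module.Basis O A (MvPolynomial (Fin n) A ⧸ ideal O g),
    ∀ t : O, B t = Ideal.Quotient.mk (ideal O g) (MvPolynomial.monomial (t : Fin n →₀ ℕ) 1)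

/-- `g` is an `O`-border basis (of the ideal that it generates). -/
def IsBasis (O : Set (Fin n →₀ ℕ)) (g : (Fin n →₀ ℕ) → MvPolynomial (Fin n) A) : Prop :=
  IsPrebasis O g ∧ IsFreeWithBasis O g

open scoped Classical in
/-- The `A`-linear operation that replaces every boundary monomial `b` occurring in `p` by
`b - g b` and leaves all other monomials alone. -/
def reduce (O : Set (Fin n →₀ ℕ)) (g : (Fin n →₀ ℕ) → MvPolynomial (Fin n) A)
    (p : MvPolynomial (Fin n) A) : MvPolynomial (Fin n) A :=
  ∑ m ∈ p.support, MvPolynomial.C (p.coeff m) *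
    (if m ∈ boundary O then MvPolynomial.monomial m 1 - g m else MvPolynomial.monomial m 1)

/-- `p → q (mod g)`: `p` is a linear combination of basis and boundary monomials, and `q` is
the result of replacing its boundary monomials by means of `g`. -/
def ReducesTo (O : Set (Fin n →₀ ℕ)) (g : (Fin n →₀ ℕ) → MvPolynomial (Fin n) A)
    (p q : MvPolynomial (Fin n) A) : Prop :=
  (∀ m ∈ p.support, m ∈ O ∪ boundary O) ∧ reduce O g p = q

end Border

/-- A signature `(n, r, s, δ, w)`. -/
structure DistSignature where
  n : ℕ
  r : ℕ
  s : ℕ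
  δ : ℕ
  w : ℕ
  one_le_δ : 1 ≤ δ
  δ_lt_n : δ < n
  two_le_r : 2 ≤ r
  r_lt_s : r < s
  w_lt_r : w < r

namespace DistSignature

variable (σ : DistSignature)

/-- Exponent vectors of the monomials in `x_1, …, x_n`. -/
abbrev Mon : Type := Fin σ.n →₀ ℕ

/-- The index in `Fin n` of the variable `x_k`, `1 ≤ k ≤ n` (clamped outside that range, where it
is never used with a non-zero exponent). -/
def idx (k : ℕ) : Fin σ.n :=
  ⟨min (k - 1) (σ.n - 1), by have := σ.δ_lt_n; omega⟩

/-- The monomial `x_k ^ e`. -/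
def xpow (k e : ℕ) : σ.Mon := Finsupp.single (σ.idx k) e

/-- Lexicographic order of monomials, with `x_1 > x_2 > ⋯ > x_n`. -/
def lexLT (m m' : σ.Mon) : Prop := toLex m < toLex m'

/-- The weak form of `lexLT`. -/
def lexLE (m m' : σ.Mon) : Prop := toLex m ≤ toLex m'

/-- The monomials in `x_k, …, x_n`. -/
def monFrom (k : ℕ) : Set σ.Mon := {m | ∀ i : Fin σ.n, (i : ℕ) + 1 < k → m i = 0}

/-- The lex-minimal boundary monomial of degree `r`, `b_ℓ = x_δ ^ (r - w) x_n ^ w`. -/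
def bLast : σ.Mon := σ.xpow σ.δ (σ.r - σ.w) + σ.xpow σ.n σ.w

/-- The order ideal `O(n, r, s, δ, w)`. -/
def ordIdeal : Set σ.Mon :=
  {m | m.degree < σ.r ∨
    (σ.r ≤ m.degree ∧ m.degree ≤ σ.s ∧ m ∈ σ.monFrom σ.δ ∧
      σ.lexLT m (σ.xpow σ.n (m.degree - σ.r) + σ.bLast))}

/-- The boundary monomials. -/
abbrev bdry : Set σ.Mon := Border.boundary σ.ordIdeal

/-- The leading monomials. -/
def lead : Set σ.Mon := {m | m.degree = σ.r ∧ σ.lexLE σ.bLast m}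

/-- The trailing monomials: the basis monomials of degree `s`. -/
def trail : Set σ.Mon := {m | m ∈ σ.ordIdeal ∧ m.degree = σ.s}

/-- The basis monomials of degrees `r` through `s - 1`. -/
def tar' : Set σ.Mon := {m | m ∈ σ.ordIdeal ∧ σ.r ≤ m.degree ∧ m.degree ≤ σ.s - 1}

/-- The members of `tar'` that are divisible by `x_{δ+1} ^ w`. -/
def tar'' : Set σ.Mon := {m | m ∈ σ.tar' ∧ σ.xpow (σ.δ + 1) σ.w ≤ m}

/-- The segment `Seg(n, δ, d, (e))`: the monomials of degree `d` in `x_δ, …, x_n` that lie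
lexicographically between `x_δ ^ (d - e) x_n ^ e` and `x_δ ^ (d - e) x_{δ+1} ^ e`. -/
def seg (d e : ℕ) : Set σ.Mon :=
  {m | m ∈ σ.monFrom σ.δ ∧ m.degree = d ∧
    σ.lexLE m (σ.xpow σ.δ (d - e) + σ.xpow (σ.δ + 1) e) ∧
    σ.lexLE (σ.xpow σ.δ (d - e) + σ.xpow σ.n e) m}

/-- The set `S_L` of leading monomials in `x_δ, …, x_n`. -/
def setL : Set σ.Mon := σ.lead ∩ σ.monFrom σ.δ

/-- The set `S_D` of boundary monomials in `x_δ, …, x_n` of degrees `r + 1` through `s`. -/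
def setD : Set σ.Mon :=
  {m | m ∈ σ.bdry ∧ m ∈ σ.monFrom σ.δ ∧ σ.r + 1 ≤ m.degree ∧ m.degree ≤ σ.s}

theorem finite_trail : σ.trail.Finite :=
  (Finsupp.finite_of_degree_le σ.s).subset fun _ hm => hm.2.le

theorem finite_tar'' : σ.tar''.Finite :=
  (Finsupp.finite_of_degree_le (σ.s - 1)).subset fun _ hm => hm.1.2.2

instance : Fintype σ.trail := σ.finite_trail.fintype

instance : Fintype σ.tar'' := σ.finite_tar''.fintype

variable (K : Type*) [Field K]

/-- The coefficient ring `K[D, Θ]`, with one indeterminate `C_{t,b}` for each leading monomial `b`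
and trailing monomial `t`, and one indeterminate `θ_t` for each `t ∈ tar''`. -/
abbrev CoeffRing : Type _ := MvPolynomial ((σ.lead × σ.trail) ⊕ σ.tar'') K

/-- The polynomial ring `K[D, Θ][x_1, …, x_n]`. -/
abbrev Poly : Type _ := MvPolynomial (Fin σ.n) (σ.CoeffRing K)

/-- A monomial as an element of `K[D, Θ][x_1, …, x_n]`. -/
def mono (m : σ.Mon) : σ.Poly K := MvPolynomial.monomial m 1

/-- The distinguished indeterminate belonging to a leading monomial `b` and a trailing monomial
`t`. -/
def indC (b : σ.lead) (t : σ.trail) : σ.CoeffRing K := MvPolynomial.X (Sum.inl (b, t))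

/-- The indeterminate `θ_t`, for `t ∈ tar''`. -/
def indTheta (t : σ.tar'') : σ.CoeffRing K := MvPolynomial.X (Sum.inr t)

open scoped Classical in
/-- The generic distinguished `O`-border pre-basis: `b` if `b` is not a leading monomial, and
`b - ∑_t C_{t,b} t` (sum over the trailing monomials `t`) if it is. -/
def genDist (b : σ.Mon) : σ.Poly K :=
  if h : b ∈ σ.lead then
    σ.mono K b - ∑ t : σ.trail, MvPolynomial.C (σ.indC K ⟨b, h⟩ t) * σ.mono K t
  else σ.mono K b

/-- Step 1, initial assignment: the target `∑ θ_t t` (sum over `t ∈ tar''`) of the monomial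
`x_δ ^ (r - w) x_{δ+1} ^ w`. -/
def initTarget : σ.Poly K :=
  ∑ t : σ.tar'', MvPolynomial.C (σ.indTheta K t) * σ.mono K t

/-- For `m = x_δ ^ (d - e_0) x_{δ+1} ^ (e_0 - e_1) x_{δ+2} ^ (e_1 - e_2) ⋯ x_n ^ e_{n-δ-1}` this is
the exponent `e_q`, that is, the degree of `m` in the variables `x_{δ+q+1}, …, x_n`. -/
def expo (m : σ.Mon) (q : ℕ) : ℕ :=
  ∑ i : Fin σ.n, if σ.δ + q ≤ (i : ℕ) then m i else 0

variable {K} in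
/-- The first `q` stages of the path of across-the-street neighbors that leads from the
lex-maximal element `x_δ ^ (r - e) x_{δ+1} ^ e` of a segment to its element `m`, when the former
has the target `P`: the `q`-th stage consists of `e_q` steps, each of which
multiplies the target by `x_{δ+q+1}` and divides it by `x_{δ+q}`. -/
def alongPath (m : σ.Mon) (P : σ.Poly K) : ℕ → σ.Poly K
  | 0 => P
  | q + 1 =>
      (fun Q => (σ.mono K (σ.xpow (σ.δ + q + 2) 1) * Q).divMonomial
        (σ.xpow (σ.δ + q + 1) 1))^[σ.expo m (q + 1)] (alongPath m P q)

variable {K} in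
/-- The target of the element `m` of a segment whose lex-maximal element has the target `P`. -/
def spread (m : σ.Mon) (P : σ.Poly K) : σ.Poly K := σ.alongPath m P (σ.n - σ.δ - 1)

variable {K} in
/-- Removal of all terms of degree `> s`. -/
def truncate (p : σ.Poly K) : σ.Poly K :=
  ∑ m ∈ p.support with m.degree ≤ σ.s, MvPolynomial.monomial m (p.coeff m)

open scoped Classical in
/-- Step 2: writing `b = m' b'` with `b' ∈ Seg(n, δ, r, (w))` and `m'` a monomial in the back
variables `x_{δ+1}, …, x_n` with `1 ≤ deg m' ≤ s - r` (any such factorization may be taken), the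
target of `b ∈ S_D` is `m'` times the target of `b'`, with the terms of degree `> s` removed. -/
def targetD (b : σ.Mon) : σ.Poly K :=
  if h : b ∈ σ.setD ∧ ∃ f : σ.Mon × σ.Mon, f.1 ∈ σ.monFrom (σ.δ + 1) ∧ 1 ≤ f.1.degree ∧
      f.1.degree ≤ σ.s - σ.r ∧ f.2 ∈ σ.seg σ.r σ.w ∧ b = f.1 + f.2 then
    σ.truncate (σ.mono K h.2.choose.1 * σ.spread h.2.choose.2 (σ.initTarget K))
  else 0

/-- Step 3: the target of `x_δ ^ (r - e) x_{δ+1} ^ e`, for `e = w - u`. It is obtained from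
the target of `x_δ ^ (r - (e + 1)) x_{δ+1} ^ (e + 1)` by multiplying by `x_δ`, reducing, and
dividing by `x_{δ+1}`. Since the boundary monomials that occur here all lie in `S_D`, the reduction
uses only the targets assigned in Step 2. -/
def lexMaxTarget : ℕ → σ.Poly K
  | 0 => σ.initTarget K
  | u + 1 =>
      (Border.reduce σ.ordIdeal (fun b => σ.genDist K b + σ.targetD K b)
        (σ.mono K (σ.xpow σ.δ 1) * lexMaxTarget u)).divMonomial (σ.xpow (σ.δ + 1) 1)

open scoped Classical in
/-- The generic target assignment `Υ`: as in Step 2 on `S_D`; on the segment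
`Seg(n, δ, r, (e)) ⊆ S_L`, the targets obtained from that of its lex-maximal element; and `0` on all
other boundary monomials. -/
def target (b : σ.Mon) : σ.Poly K :=
  if b ∈ σ.setD then σ.targetD K b
  else if b ∈ σ.setL then σ.spread b (σ.lexMaxTarget K (σ.w - σ.expo b 0))
  else 0

/-- The generic modification of the generic distinguished `O`-border pre-basis. -/
def genMod (b : σ.Mon) : σ.Poly K := σ.genDist K b + σ.target K b

end DistSignature

end

/-! ### Linear maps on polynomials with restricted support -/

noncomputable section

/-! Everything follows from a single ideal `I` that contains every `genMod b`, `b ∈ ∂O`, and meets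
the span of `O` only in 0. An S-polynomial lies in `I` and in the span of `O ∪ ∂O`; reduction
changes it by an element of `I` and lands in the span of `O`, hence gives 0. Freeness holds because
any border pre-basis with `1 ∈ O` makes the span of `O` and its ideal add up to the whole ring, and
`I` makes this sum direct (`isFreeWithBasis`).

To find `I`, note that the whole target assignment encodes one relation. The initial target is
divisible by `x_{δ+1}^w`; with quotient `relTail`, put `rel = x_δ^(r-w) + relTail`, where `relTail`
has smaller exponents of `x_δ` and no terms of degree below `r-w`. Multiplying by `x_δ` and reducing
is rewriting modulo `rel`, so the target of `b` in `S_L ∪ S_D` is minus the normal form of `b`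
modulo `rel`, truncated (`targetD_eq`, `lexMaxTarget_eq`, `target_of_mem_setL`). Let `relIdeal` be
generated by `rel`, the monomials involving `x_1, …, x_{δ-1}`, and those of degree above `s`. A
degree argument shows that no nonzero combination of normal monomials of degree at most `s` lies in
it (`eq_zero_of_mem_relIdeal`).

Nonleading members of the family lie in `relIdeal`. A leading member misses it by a combination `T
b` of trailing monomials: the arbitrary `C_{t,b}` terms, and the degree `s` part of the normal form,
as targets on `S_L` stop at degree `s-1`. This is repaired by a twist: `I` consists of the `p` with
all terms of degree at least `r` for which `p + twist T p ∈ relIdeal`. It is an ideal because one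
multiplication by a variable pushes leading monomials past degree `r`, where the twist vanishes, and
trailing monomials past degree `s`, where everything is killed. -/

open MvPolynomial in
theorem MvPolynomial.restrictSupport_le_iff {ι A : Type*} [CommSemiring A] {s : Set (ι →₀ ℕ)}
    {W : Submodule A (MvPolynomial ι A)} :
    restrictSupport A s ≤ W ↔ ∀ m ∈ s, monomial m (1 : A) ∈ W := by
  rw [restrictSupport_eq_span, Submodule.span_le, Set.image_subset_iff]
  rfl

open MvPolynomial in
theorem MvPolynomial.eqOn_restrictSupport {ι A M : Type*} [CommSemiring A] [AddCommMonoid M]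
    [Module A M] {s : Set (ι →₀ ℕ)} {f g : MvPolynomial ι A →ₗ[A] M}
    (h : ∀ m ∈ s, f (monomial m 1) = g (monomial m 1)) {p : MvPolynomial ι A}
    (hp : p ∈ restrictSupport A s) : f p = g p :=
  restrictSupport_le_iff (W := LinearMap.eqLocus f g).2 h hp

open MvPolynomial in
theorem MvPolynomial.monomial_one_mem_restrictSupport {ι A : Type*} [CommSemiring A]
    {s : Set (ι →₀ ℕ)} {m : ι →₀ ℕ} (hm : m ∈ s) : monomial m (1 : A) ∈ restrictSupport A s :=
  (monomial_mem_restrictSupport A).2 (Or.inl hm)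

open MvPolynomial in
/-- The linear map with prescribed values on monomials. -/
def MvPolynomial.monomialLift {ι M : Type*} (A : Type*) [CommSemiring A] [AddCommMonoid M]
    [Module A M] (f : (ι →₀ ℕ) → M) : MvPolynomial ι A →ₗ[A] M :=
  (basisMonomials ι A).constr A f

open MvPolynomial in
theorem MvPolynomial.monomialLift_monomial {ι A M : Type*} [CommSemiring A] [AddCommMonoid M]
    [Module A M] (f : (ι →₀ ℕ) → M) (m : ι →₀ ℕ) : monomialLift A f (monomial m 1) = f m :=
  (basisMonomials ι A).constr_basis A f m

/-! ### Criterion for border bases: an ideal meeting the span of `O` trivially -/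

namespace Border

open MvPolynomial

variable {n : ℕ} {A : Type*} [CommRing A] {O : Set (Fin n →₀ ℕ)}
  {g : (Fin n →₀ ℕ) → MvPolynomial (Fin n) A}

open scoped Classical in
/-- `reduce` as a linear map. -/
def reduceₗ (O : Set (Fin n →₀ ℕ)) (g : (Fin n →₀ ℕ) → MvPolynomial (Fin n) A) :
    MvPolynomial (Fin n) A →ₗ[A] MvPolynomial (Fin n) A :=
  monomialLift A fun m =>
    if m ∈ boundary O then monomial m 1 - g m else monomial m 1

open scoped Classical in
theorem reduceₗ_monomial (m : Fin n →₀ ℕ) :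
    reduceₗ O g (monomial m 1) =
      if m ∈ boundary O then monomial m 1 - g m else monomial m 1 :=
  monomialLift_monomial _ m

theorem reduce_eq_reduceₗ (p : MvPolynomial (Fin n) A) : reduce O g p = reduceₗ O g p := by
  classical
  conv_rhs => rw [← p.support_sum_monomial_coeff]
  rw [map_sum, reduce]
  refine Finset.sum_congr rfl fun m _ => ?_
  rw [show monomial m (coeff m p) = coeff m p • monomial m (1 : A) by
    rw [smul_monomial, smul_eq_mul, mul_one], map_smul, reduceₗ_monomial, smul_eq_C_mul]

theorem sub_reduce_mem {I : Ideal (MvPolynomial (Fin n) A)} (hI : ∀ b ∈ boundary O, g b ∈ I)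
    (p : MvPolynomial (Fin n) A) : p - reduce O g p ∈ I := by
  rw [reduce_eq_reduceₗ]
  have h : restrictSupport A (Set.univ : Set (Fin n →₀ ℕ)) ≤
      (I.restrictScalars A).comap (LinearMap.id - reduceₗ O g) := by
    rw [restrictSupport_le_iff]
    intro m _
    simp only [Submodule.mem_comap, LinearMap.sub_apply, LinearMap.id_apply, reduceₗ_monomial,
      Submodule.restrictScalars_mem]
    split_ifs with hm
    · simpa using hI m hm
    · simp
  exact h (by simp)

theorem reduce_mem (hg : IsPrebasis O g) {p : MvPolynomial (Fin n) A}
    (hp : p ∈ restrictSupport A (O ∪ boundary O)) : reduce O g p ∈ restrictSupport A O := by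
  rw [reduce_eq_reduceₗ]
  refine restrictSupport_le_iff (W := (restrictSupport A O).comap (reduceₗ O g)) |>.2 ?_ hp
  intro m hm
  rw [Submodule.mem_comap, reduceₗ_monomial]
  split_ifs with h
  · rw [← Submodule.neg_mem_iff, neg_sub]
    exact fun t ht => hg m h t ht
  · exact monomial_one_mem_restrictSupport (hm.resolve_right h)

theorem X_mul_mem {p : MvPolynomial (Fin n) A} (i : Fin n) (hp : p ∈ restrictSupport A O) :
    X i * p ∈ restrictSupport A (O ∪ boundary O) := by
  refine restrictSupport_le_iff
    (W := (restrictSupport A (O ∪ boundary O)).comap (LinearMap.mulLeft A (X i))) |>.2 ?_ hp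
  intro m hm
  rw [Submodule.mem_comap, LinearMap.mulLeft_apply, mul_comm, X, monomial_mul, one_mul]
  refine monomial_one_mem_restrictSupport ?_
  by_cases h : m + Finsupp.single i 1 ∈ O
  · exact Or.inl h
  · exact Or.inr ⟨h, m, hm, i, rfl⟩

theorem IsPrebasis.sub_mem (hg : IsPrebasis O g) {b : Fin n →₀ ℕ} (hb : b ∈ boundary O) :
    g b - monomial b 1 ∈ restrictSupport A O :=
  fun t ht => hg b hb t ht

/-- Reduction moves `p` only within its class modulo `I`, and its result lies in the span of `O`,
where `I` has no nonzero element. -/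
theorem reducesTo_zero (hg : IsPrebasis O g) {I : Ideal (MvPolynomial (Fin n) A)}
    (hI : ∀ b ∈ boundary O, g b ∈ I) (hO : ∀ p ∈ I, p ∈ restrictSupport A O → p = 0)
    {p : MvPolynomial (Fin n) A} (hp : p ∈ restrictSupport A (O ∪ boundary O)) (hpI : p ∈ I) :
    ReducesTo O g p 0 := by
  refine ⟨fun m hm => hp hm, hO _ ?_ (reduce_mem hg hp)⟩
  simpa using I.sub_mem hpI (sub_reduce_mem hI p)

theorem reducesTo_nextDoor (hg : IsPrebasis O g) {I : Ideal (MvPolynomial (Fin n) A)}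
    (hI : ∀ b ∈ boundary O, g b ∈ I) (hO : ∀ p ∈ I, p ∈ restrictSupport A O → p = 0)
    {b₁ b₂ : Fin n →₀ ℕ} (h₁ : b₁ ∈ boundary O) (h₂ : b₂ ∈ boundary O) (i : Fin n)
    (h : b₁ + Finsupp.single i 1 = b₂) : ReducesTo O g (X i * g b₁ - g b₂) 0 := by
  refine reducesTo_zero hg hI hO ?_ (I.sub_mem (I.mul_mem_left _ (hI _ h₁)) (hI _ h₂))
  -- The head terms cancel. Without this, `X i * b₁` could leave `O ∪ ∂O`.
  have e : X i * g b₁ - g b₂ = X i * (g b₁ - monomial b₁ 1) - (g b₂ - monomial b₂ 1) := by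
    have : (X i * monomial b₁ 1 : MvPolynomial (Fin n) A) = monomial b₂ 1 := by
      rw [mul_comm, X, monomial_mul, h, one_mul]
    rw [mul_sub, this]; ring
  rw [e]
  exact Submodule.sub_mem _ (X_mul_mem i (hg.sub_mem h₁))
    (restrictSupport_mono A Set.subset_union_left (hg.sub_mem h₂))

theorem reducesTo_acrossStreet (hg : IsPrebasis O g) {I : Ideal (MvPolynomial (Fin n) A)}
    (hI : ∀ b ∈ boundary O, g b ∈ I) (hO : ∀ p ∈ I, p ∈ restrictSupport A O → p = 0)
    {b₁ b₂ : Fin n →₀ ℕ} (h₁ : b₁ ∈ boundary O) (h₂ : b₂ ∈ boundary O) (i j : Fin n)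
    (h : b₁ + Finsupp.single i 1 = b₂ + Finsupp.single j 1) :
    ReducesTo O g (X i * g b₁ - X j * g b₂) 0 := by
  refine reducesTo_zero hg hI hO ?_
    (I.sub_mem (I.mul_mem_left _ (hI _ h₁)) (I.mul_mem_left _ (hI _ h₂)))
  have e : X i * g b₁ - X j * g b₂ =
      X i * (g b₁ - monomial b₁ 1) - X j * (g b₂ - monomial b₂ 1) := by
    have : (X i * monomial b₁ 1 : MvPolynomial (Fin n) A) = X j * monomial b₂ 1 := by
      rw [mul_comm, X, monomial_mul, h, mul_comm (X j), X, monomial_mul]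
    rw [mul_sub, mul_sub, this]; ring
  rw [e]
  exact Submodule.sub_mem _ (X_mul_mem i (hg.sub_mem h₁)) (X_mul_mem j (hg.sub_mem h₂))

/-- Border division: modulo the ideal the span of `O` contains 1 and is stable under each variable,
since `X i * O ⊆ O ∪ ∂O` and boundary monomials reduce into the span. -/
theorem sup_ideal_eq_top (hg : IsPrebasis O g) (h0 : 0 ∈ O) :
    restrictSupport A O ⊔ (ideal O g).restrictScalars A = ⊤ := by
  have hgen : ∀ b ∈ boundary O, g b ∈ ideal O g := fun b hb =>
    Ideal.subset_span (Set.mem_image_of_mem g hb)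
  rw [eq_top_iff]
  rintro p -
  induction p using MvPolynomial.induction_on with
  | C a =>
    refine Submodule.mem_sup_left ?_
    rw [← monomial_zero']
    exact (monomial_mem_restrictSupport A).2 (Or.inl h0)
  | add p q hp hq => exact Submodule.add_mem _ hp hq
  | mul_X p i hp =>
    obtain ⟨y, hy, z, hz, rfl⟩ := Submodule.mem_sup.1 hp
    have hr := sub_reduce_mem hgen (X i * y)
    refine Submodule.mem_sup.2 ⟨reduce O g (X i * y), reduce_mem hg (X_mul_mem i hy),
      (X i * y - reduce O g (X i * y)) + z * X i, ?_, by ring⟩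
    exact Submodule.add_mem _ hr (Ideal.mul_mem_right _ _ hz)

theorem isFreeWithBasis (hg : IsPrebasis O g) (h0 : 0 ∈ O)
    {I : Ideal (MvPolynomial (Fin n) A)} (hI : ∀ b ∈ boundary O, g b ∈ I)
    (hO : ∀ p ∈ I, p ∈ restrictSupport A O → p = 0) : IsFreeWithBasis O g := by
  have hle : ideal O g ≤ I := Ideal.span_le.2 (by rintro _ ⟨b, hb, rfl⟩; exact hI b hb)
  let e : restrictSupport A O →ₗ[A] MvPolynomial (Fin n) A ⧸ ideal O g :=
    (Ideal.Quotient.mkₐ A (ideal O g)).toLinearMap ∘ₗ (restrictSupport A O).subtype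
  have he : ∀ p, e p = Ideal.Quotient.mk (ideal O g) p := fun _ => rfl
  have hb : Function.Bijective e := by
    constructor
    · rw [← LinearMap.ker_eq_bot, LinearMap.ker_eq_bot']
      intro p hp
      rw [he, Ideal.Quotient.eq_zero_iff_mem] at hp
      exact Subtype.ext (hO _ (hle hp) p.2)
    · intro q
      obtain ⟨q, rfl⟩ := Ideal.Quotient.mk_surjective q
      have hq : q ∈ restrictSupport A O ⊔ (ideal O g).restrictScalars A := by
        rw [sup_ideal_eq_top hg h0]; trivial
      obtain ⟨y, hy, z, hz, rfl⟩ := Submodule.mem_sup.1 hq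
      refine ⟨⟨y, hy⟩, ?_⟩
      rw [he, map_add, Ideal.Quotient.eq_zero_iff_mem.2 hz, add_zero]
  refine ⟨(basisRestrictSupport A O).map (LinearEquiv.ofBijective e hb), fun t => ?_⟩
  rw [Module.Basis.map_apply, LinearEquiv.ofBijective_apply, he]
  congr 1
  exact congrArg Subtype.val
    ((Module.Basis.apply_eq_iff (i := t) (b := basisRestrictSupport A O)
      (x := ⟨monomial t 1, monomial_one_mem_restrictSupport t.2⟩)).2
      (by ext u; simp only [Finsupp.single_apply, Subtype.ext_iff]; exact coeff_monomial _ _ _))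

end Border

end

/-! ### Lexicographic conditions as bounds on the exponent of `x_δ` -/

noncomputable section

theorem Finsupp.degree_lt_degree_of_le {ι : Type*} [Fintype ι] {m m' : ι →₀ ℕ} (h : m ≤ m')
    (i : ι) (hi : m i < m' i) : m.degree < m'.degree := by
  rw [degree_eq_sum, degree_eq_sum]
  exact Finset.sum_lt_sum (fun j _ => h j) ⟨i, Finset.mem_univ i, hi⟩

theorem Finsupp.degree_erase_add {ι : Type*} (m : ι →₀ ℕ) (i : ι) :
    m i + (m.erase i).degree = m.degree := by
  conv_rhs => rw [← Finsupp.single_add_erase i m, map_add, degree_single]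

namespace DistSignature

variable (σ : DistSignature)

theorem idx_val {k : ℕ} (hk : k ≤ σ.n) : (σ.idx k : ℕ) = k - 1 := by
  simp only [idx]; omega

theorem idx_δ_val : (σ.idx σ.δ : ℕ) = σ.δ - 1 := σ.idx_val σ.δ_lt_n.le

theorem idx_succ_ne : σ.idx (σ.δ + 1) ≠ σ.idx σ.δ := by
  have := σ.one_le_δ
  rw [ne_eq, Fin.ext_iff, σ.idx_val σ.δ_lt_n, σ.idx_δ_val]
  omega

theorem idx_n_ne : σ.idx σ.n ≠ σ.idx σ.δ := by
  have := σ.one_le_δ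
  have := σ.δ_lt_n
  rw [ne_eq, Fin.ext_iff, σ.idx_val le_rfl, σ.idx_δ_val]
  omega

variable {σ}

theorem lexLT_iff {m m' : σ.Mon} :
    σ.lexLT m m' ↔ ∃ i, (∀ j < i, m j = m' j) ∧ m i < m' i :=
  Finsupp.Lex.lt_iff

theorem lexLE_iff_not_lexLT {m m' : σ.Mon} : σ.lexLE m m' ↔ ¬ σ.lexLT m' m :=
  not_lt.symm

theorem mem_monFrom {k : ℕ} {m : σ.Mon} (hk : k ≤ σ.n) :
    m ∈ σ.monFrom k ↔ ∀ i < σ.idx k, m i = 0 := by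
  simp only [monFrom, Set.mem_ofPred_eq, Fin.lt_def, σ.idx_val hk, Nat.lt_sub_iff_add_lt]

theorem mem_monFrom_δ {m : σ.Mon} : m ∈ σ.monFrom σ.δ ↔ ∀ i < σ.idx σ.δ, m i = 0 :=
  mem_monFrom σ.δ_lt_n.le

theorem mem_monFrom_succ {m : σ.Mon} :
    m ∈ σ.monFrom (σ.δ + 1) ↔ m ∈ σ.monFrom σ.δ ∧ m (σ.idx σ.δ) = 0 := by
  have h1 := σ.one_le_δ
  rw [mem_monFrom_δ]
  simp only [monFrom, Set.mem_ofPred_eq, Fin.lt_def, σ.idx_δ_val]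
  constructor
  · intro h
    refine ⟨fun i hi => h i (by omega), h _ ?_⟩
    rw [σ.idx_δ_val]; omega
  · rintro ⟨h, h'⟩ i hi
    rcases lt_or_ge (i : ℕ) (σ.δ - 1) with hlt | hge
    · exact h i hlt
    · rwa [show i = σ.idx σ.δ from Fin.ext (by rw [σ.idx_δ_val]; omega)]

theorem xpow_mem_monFrom {k e : ℕ} (hk : σ.δ ≤ k) (hn : k ≤ σ.n) :
    σ.xpow k e ∈ σ.monFrom σ.δ := by
  intro i hi
  rw [xpow, Finsupp.single_apply, if_neg]
  rintro rfl
  rw [σ.idx_val hn] at hi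
  omega

theorem monFrom_add {k : ℕ} {m m' : σ.Mon} :
    m + m' ∈ σ.monFrom k ↔ m ∈ σ.monFrom k ∧ m' ∈ σ.monFrom k := by
  constructor
  · intro h
    refine ⟨fun i hi => ?_, fun i hi => ?_⟩ <;>
    · have := h i hi
      rw [Finsupp.add_apply] at this
      omega
  · rintro ⟨h, h'⟩ i hi
    rw [Finsupp.add_apply, h i hi, h' i hi]

theorem monFrom_of_le {k : ℕ} {m m' : σ.Mon} (hle : m ≤ m') (h : m' ∈ σ.monFrom k) :
    m ∈ σ.monFrom k :=
  fun i hi => Nat.le_zero.1 ((hle i).trans (h i hi).le)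

theorem lexLT_of_front_lt {m m' : σ.Mon} (hm : m ∈ σ.monFrom σ.δ) (hm' : m' ∈ σ.monFrom σ.δ)
    (h : m (σ.idx σ.δ) < m' (σ.idx σ.δ)) : σ.lexLT m m' :=
  lexLT_iff.2 ⟨σ.idx σ.δ, fun j hj => by
    rw [mem_monFrom_δ.1 hm j hj, mem_monFrom_δ.1 hm' j hj], h⟩

theorem xpow_add_front {k p c : ℕ} (h : σ.idx k ≠ σ.idx σ.δ) :
    (σ.xpow σ.δ p + σ.xpow k c) (σ.idx σ.δ) = p := by
  simp [xpow, h]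

theorem xpow_add_apply {k p c : ℕ} {i : Fin σ.n} (hi : i ≠ σ.idx σ.δ) :
    (σ.xpow σ.δ p + σ.xpow k c) i = if σ.idx k = i then c else 0 := by
  simp [xpow, Finsupp.single_apply, hi.symm]

theorem degree_xpow_add (k p c : ℕ) : (σ.xpow σ.δ p + σ.xpow k c).degree = p + c := by
  rw [map_add, xpow, xpow, Finsupp.degree_single, Finsupp.degree_single]

/-- Among the monomials of its degree in `x_δ, …, x_n` whose `x_δ`-exponent is `p`, `x_δ^p x_n^c` is
the lex-smallest. This removes the lexicographic order from the definition of `O`. -/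
theorem lexLT_xpow_n_iff {m : σ.Mon} (hm : m ∈ σ.monFrom σ.δ) {p c : ℕ}
    (hd : m.degree = p + c) :
    σ.lexLT m (σ.xpow σ.δ p + σ.xpow σ.n c) ↔ m (σ.idx σ.δ) < p := by
  have hn := σ.δ_lt_n
  have hN : σ.xpow σ.δ p + σ.xpow σ.n c ∈ σ.monFrom σ.δ :=
    monFrom_add.2 ⟨xpow_mem_monFrom le_rfl hn.le, xpow_mem_monFrom hn.le le_rfl⟩
  constructor
  · intro h
    obtain ⟨i, hi, hlt⟩ := lexLT_iff.1 h
    by_contra! hp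
    rcases lt_trichotomy i (σ.idx σ.δ) with hid | rfl | hid
    · rw [mem_monFrom_δ.1 hN i hid] at hlt
      omega
    · rw [xpow_add_front σ.idx_n_ne] at hlt
      omega
    · rw [xpow_add_apply hid.ne'] at hlt
      split_ifs at hlt with hin
      -- A first difference beyond `x_δ` can only be at `x_n`, the last variable; then one monomial
      -- properly divides the other, although their degrees agree.
      · have hle : m ≤ σ.xpow σ.δ p + σ.xpow σ.n c := by
          intro j
          rcases lt_or_ge j i with hj | hj
          · exact (hi j hj).le
          · have : j = i := by
              refine le_antisymm ?_ hj
              rw [← hin, Fin.le_def, σ.idx_val le_rfl]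
              omega
            subst this
            rw [xpow_add_apply hid.ne', if_pos hin]
            exact hlt.le
        have := Finsupp.degree_lt_degree_of_le hle i
          (by rwa [xpow_add_apply hid.ne', if_pos hin])
        rw [degree_xpow_add] at this
        omega
      · omega
  · intro h
    exact lexLT_of_front_lt hm hN (by rwa [xpow_add_front σ.idx_n_ne])

theorem lexLE_xpow_succ_iff {m : σ.Mon} (hm : m ∈ σ.monFrom σ.δ) {p c : ℕ}
    (hd : m.degree = p + c) :
    σ.lexLE m (σ.xpow σ.δ p + σ.xpow (σ.δ + 1) c) ↔ m (σ.idx σ.δ) ≤ p := by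
  have hn := σ.δ_lt_n
  have hN : σ.xpow σ.δ p + σ.xpow (σ.δ + 1) c ∈ σ.monFrom σ.δ :=
    monFrom_add.2 ⟨xpow_mem_monFrom le_rfl hn.le, xpow_mem_monFrom (Nat.le_succ _) hn⟩
  rw [lexLE_iff_not_lexLT]
  constructor
  · intro h
    by_contra! hp
    exact h (lexLT_of_front_lt hN hm (by rwa [xpow_add_front σ.idx_succ_ne]))
  · intro hp h
    obtain ⟨i, hi, hlt⟩ := lexLT_iff.1 h
    rcases lt_trichotomy i (σ.idx σ.δ) with hid | rfl | hid
    · rw [mem_monFrom_δ.1 hm i hid] at hlt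
      omega
    · rw [xpow_add_front σ.idx_succ_ne] at hlt
      omega
    · have hle : σ.xpow σ.δ p + σ.xpow (σ.δ + 1) c ≤ m := by
        intro j
        rcases lt_trichotomy j i with hj | rfl | hj
        · exact (hi j hj).le
        · exact hlt.le
        · rw [xpow_add_apply (hid.trans hj).ne', if_neg]
          · exact Nat.zero_le _
          · rintro rfl
            rw [Fin.lt_def] at hid hj
            rw [σ.idx_val hn] at hj
            rw [σ.idx_δ_val] at hid
            omega
      have := Finsupp.degree_lt_degree_of_le hle i hlt
      rw [degree_xpow_add] at this
      omega

theorem mem_ordIdeal {m : σ.Mon} : m ∈ σ.ordIdeal ↔ m.degree < σ.r ∨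
    (σ.r ≤ m.degree ∧ m.degree ≤ σ.s ∧ m ∈ σ.monFrom σ.δ ∧ m (σ.idx σ.δ) < σ.r - σ.w) := by
  have hw := σ.w_lt_r
  refine or_congr_right (and_congr_right fun h => and_congr_right fun _ =>
    and_congr_right fun hm => ?_)
  rw [← lexLT_xpow_n_iff hm (c := m.degree - σ.r + σ.w) (by omega), bLast, add_left_comm,
    xpow, xpow, xpow, xpow, ← Finsupp.single_add]

/-- A monomial lex-below `b_ℓ` cannot involve `x_1, …, x_{δ-1}`, so in degree `r` being below `b_ℓ`
already forces membership in `O`. -/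
theorem mem_lead {m : σ.Mon} : m ∈ σ.lead ↔ m.degree = σ.r ∧ m ∉ σ.ordIdeal := by
  have hn := σ.δ_lt_n
  have hw := σ.w_lt_r
  have hs := σ.r_lt_s
  refine and_congr_right fun hd => ?_
  rw [lexLE_iff_not_lexLT, not_iff_not, mem_ordIdeal]
  constructor
  · intro h
    have hm : m ∈ σ.monFrom σ.δ := by
      obtain ⟨i, hi, hlt⟩ := lexLT_iff.1 h
      have hb : σ.bLast ∈ σ.monFrom σ.δ :=
        monFrom_add.2 ⟨xpow_mem_monFrom le_rfl hn.le, xpow_mem_monFrom hn.le le_rfl⟩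
      rw [mem_monFrom_δ] at hb ⊢
      intro j hj
      rcases lt_or_ge j i with hji | hji
      · rw [hi j hji, hb j hj]
      · rw [hb i (hji.trans_lt hj)] at hlt
        omega
    exact Or.inr ⟨hd.ge, by omega, hm, (lexLT_xpow_n_iff hm (by omega)).1 h⟩
  · rintro (h | ⟨-, -, hm, h⟩)
    · omega
    · exact (lexLT_xpow_n_iff hm (by omega)).2 h

theorem mem_setL {m : σ.Mon} :
    m ∈ σ.setL ↔ m ∈ σ.monFrom σ.δ ∧ m.degree = σ.r ∧ σ.r - σ.w ≤ m (σ.idx σ.δ) := by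
  have hs := σ.r_lt_s
  rw [setL, Set.mem_inter_iff, mem_lead, mem_ordIdeal]
  constructor
  · rintro ⟨⟨hd, h⟩, hm⟩
    refine ⟨hm, hd, ?_⟩
    by_contra! hlt
    exact h (Or.inr ⟨hd.ge, by omega, hm, hlt⟩)
  · rintro ⟨hm, hd, h⟩
    exact ⟨⟨hd, by rintro (h' | ⟨-, -, -, h'⟩) <;> omega⟩, hm⟩

theorem mem_seg_w {m : σ.Mon} : m ∈ σ.seg σ.r σ.w ↔
    m ∈ σ.monFrom σ.δ ∧ m.degree = σ.r ∧ m (σ.idx σ.δ) = σ.r - σ.w := by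
  have hw := σ.w_lt_r
  refine and_congr_right fun hm => and_congr_right fun hd => ?_
  rw [lexLE_xpow_succ_iff hm (by omega), lexLE_iff_not_lexLT, lexLT_xpow_n_iff hm (by omega)]
  omega

theorem degree_of_mem_bdry {b : σ.Mon} (hb : b ∈ σ.bdry) :
    σ.r ≤ b.degree ∧ b.degree ≤ σ.s + 1 := by
  obtain ⟨hb, t, ht, i, rfl⟩ := hb
  have hs := σ.r_lt_s
  rw [mem_ordIdeal] at hb ht
  have : (t + Finsupp.single i 1).degree = t.degree + 1 := by
    rw [map_add, Finsupp.degree_single]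
  constructor
  · by_contra! h
    exact hb (Or.inl h)
  · rcases ht with h | ⟨-, h, -⟩ <;> omega

/-- A boundary monomial here is one variable away from an element of `O` with `x_δ`-exponent below
`r - w`, so its own exponent just reaches the threshold. -/
theorem mem_setD {m : σ.Mon} : m ∈ σ.setD ↔ m ∈ σ.monFrom σ.δ ∧ σ.r + 1 ≤ m.degree ∧
    m.degree ≤ σ.s ∧ m (σ.idx σ.δ) = σ.r - σ.w := by
  have hw := σ.w_lt_r
  constructor
  · rintro ⟨⟨hb, t, ht, i, rfl⟩, hm, hr, hs⟩
    refine ⟨hm, hr, hs, ?_⟩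
    rw [mem_ordIdeal] at hb ht
    rw [map_add, Finsupp.degree_single] at *
    have ht' : t (σ.idx σ.δ) < σ.r - σ.w := by
      rcases ht with h | ⟨-, -, -, h⟩
      · omega
      · exact h
    refine le_antisymm ?_ ?_
    · rw [Finsupp.add_apply, Finsupp.single_apply]
      split_ifs <;> omega
    · by_contra! h
      exact hb (Or.inr ⟨by omega, hs, hm, h⟩)
  · rintro ⟨hm, hr, hs, hd⟩
    refine ⟨⟨?_, m - Finsupp.single (σ.idx σ.δ) 1, ?_, σ.idx σ.δ, ?_⟩, hm, hr, hs⟩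
    · rw [mem_ordIdeal]
      rintro (h | ⟨-, -, -, h⟩) <;> omega
    all_goals have hle : Finsupp.single (σ.idx σ.δ) 1 ≤ m :=
      Finsupp.single_le_iff.2 (by omega)
    · have e := congrArg Finsupp.degree (tsub_add_cancel_of_le hle)
      rw [map_add, Finsupp.degree_single] at e
      refine mem_ordIdeal.2 (Or.inr ⟨by omega, by omega, monFrom_of_le tsub_le_self hm, ?_⟩)
      rw [Finsupp.tsub_apply, Finsupp.single_eq_same]
      omega
    · exact (tsub_add_cancel_of_le hle).symm

theorem expo_zero {m : σ.Mon} (hm : m ∈ σ.monFrom σ.δ) :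
    σ.expo m 0 = (m.erase (σ.idx σ.δ)).degree := by
  have h1 := σ.one_le_δ
  rw [expo, Finsupp.degree_eq_sum]
  refine Finset.sum_congr rfl fun i _ => ?_
  rw [mem_monFrom_δ] at hm
  rcases lt_trichotomy i (σ.idx σ.δ) with h | rfl | h
  · rw [Finsupp.erase_ne h.ne, hm i h, ite_self]
  · rw [Finsupp.erase_same, if_neg]
    rw [σ.idx_δ_val]; omega
  · rw [Finsupp.erase_ne h.ne', if_pos]
    rw [Fin.lt_def, σ.idx_δ_val] at h
    omega

theorem mem_tar'' {t : σ.Mon} (ht : t ∈ σ.tar'') : t ∈ σ.monFrom σ.δ ∧ σ.r ≤ t.degree ∧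
    t.degree ≤ σ.s - 1 ∧ t (σ.idx σ.δ) < σ.r - σ.w ∧ σ.xpow (σ.δ + 1) σ.w ≤ t := by
  obtain ⟨⟨hO, hr, hs⟩, hw⟩ := ht
  rcases mem_ordIdeal.1 hO with h | ⟨-, -, hm, hd⟩
  · omega
  · exact ⟨hm, hr, hs, hd, hw⟩

end DistSignature

end

/-! ### Closed formulas for the targets, as normal forms modulo one relation -/

noncomputable section

namespace DistSignature

open MvPolynomial

variable {σ : DistSignature} {K : Type*} [Field K]

theorem mono_add (m m' : σ.Mon) : σ.mono K (m + m') = σ.mono K m * σ.mono K m' := by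
  rw [mono, mono, mono, monomial_mul, one_mul]

theorem linearMap_ext {f g : σ.Poly K →ₗ[σ.CoeffRing K] σ.Poly K}
    (h : ∀ m, f (σ.mono K m) = g (σ.mono K m)) (p : σ.Poly K) : f p = g p :=
  eqOn_restrictSupport (s := Set.univ) (fun m _ => h m) (by simp)

theorem map_restrictSupport {f : σ.Poly K →ₗ[σ.CoeffRing K] σ.Poly K} {S : Set σ.Mon}
    {W : Submodule (σ.CoeffRing K) (σ.Poly K)} (h : ∀ m ∈ S, f (σ.mono K m) ∈ W)
    {p : σ.Poly K} (hp : p ∈ restrictSupport _ S) : f p ∈ W :=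
  restrictSupport_le_iff (W := W.comap f) |>.2 h hp

theorem mono_mem {S : Set σ.Mon} {m : σ.Mon} (hm : m ∈ S) :
    σ.mono K m ∈ restrictSupport (σ.CoeffRing K) S :=
  monomial_one_mem_restrictSupport hm

/-! ### Truncation -/

/-- Removal of all terms of degree `> k`, as a linear map. -/
def truncₗ (k : ℕ) : σ.Poly K →ₗ[σ.CoeffRing K] σ.Poly K :=
  monomialLift _ fun m => if m.degree ≤ k then σ.mono K m else 0

theorem truncₗ_mono (k : ℕ) (m : σ.Mon) :
    truncₗ k (σ.mono K m) = if m.degree ≤ k then σ.mono K m else 0 :=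
  monomialLift_monomial _ m

theorem truncate_eq (p : σ.Poly K) : σ.truncate p = truncₗ σ.s p := by
  conv_rhs => rw [← p.support_sum_monomial_coeff]
  rw [map_sum, truncate, Finset.sum_filter]
  refine Finset.sum_congr rfl fun m _ => ?_
  rw [show monomial m (coeff m p) = coeff m p • σ.mono K m by
    rw [mono, smul_monomial, smul_eq_mul, mul_one], map_smul, truncₗ_mono, smul_ite, smul_zero]

theorem truncₗ_mono_mul (k : ℕ) (m : σ.Mon) (p : σ.Poly K) :
    truncₗ (m.degree + k) (σ.mono K m * p) = σ.mono K m * truncₗ k p := by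
  refine linearMap_ext (f := truncₗ (m.degree + k) ∘ₗ LinearMap.mulLeft _ (σ.mono K m))
    (g := LinearMap.mulLeft _ (σ.mono K m) ∘ₗ truncₗ k) (fun t => ?_) p
  simp only [LinearMap.comp_apply, LinearMap.mulLeft_apply, ← mono_add, truncₗ_mono, map_add,
    add_le_add_iff_left, mul_ite, mul_zero]

theorem truncₗ_mem {S : Set σ.Mon} (k : ℕ) {p : σ.Poly K} (hp : p ∈ restrictSupport _ S) :
    truncₗ k p ∈ restrictSupport (σ.CoeffRing K) (S ∩ {m | m.degree ≤ k}) := by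
  refine map_restrictSupport (fun m hm => ?_) hp
  rw [truncₗ_mono]
  split_ifs with h
  · exact mono_mem ⟨hm, h⟩
  · exact Submodule.zero_mem _

theorem sub_truncₗ_mem {S : Set σ.Mon} (k : ℕ) {p : σ.Poly K} (hp : p ∈ restrictSupport _ S) :
    p - truncₗ k p ∈ restrictSupport (σ.CoeffRing K) (S ∩ {m | k < m.degree}) := by
  refine map_restrictSupport (f := LinearMap.id - truncₗ k) (fun m hm => ?_) hp
  rw [LinearMap.sub_apply, LinearMap.id_apply, truncₗ_mono]
  split_ifs with h
  · rw [sub_self]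
    exact Submodule.zero_mem _
  · rw [sub_zero]
    exact mono_mem ⟨hm, not_le.1 h⟩

theorem truncₗ_eq_self {k : ℕ} {p : σ.Poly K} (hp : p ∈ restrictSupport _ {m | m.degree ≤ k}) :
    truncₗ k p = p :=
  eqOn_restrictSupport (g := LinearMap.id)
    (fun m hm => (truncₗ_mono k m).trans (if_pos hm)) hp

theorem truncₗ_eq_zero {k : ℕ} {p : σ.Poly K} (hp : p ∈ restrictSupport _ {m | k < m.degree}) :
    truncₗ k p = 0 :=
  eqOn_restrictSupport (g := 0) (fun m hm => (truncₗ_mono k m).trans (if_neg (not_le.2 hm))) hp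

theorem truncₗ_truncₗ {k l : ℕ} (h : k ≤ l) (p : σ.Poly K) :
    truncₗ k (truncₗ l p) = truncₗ k p := by
  refine linearMap_ext (f := truncₗ k ∘ₗ truncₗ l) (fun m => ?_) p
  rw [LinearMap.comp_apply, truncₗ_mono, truncₗ_mono]
  split_ifs with h1 h2 h2
  · rw [truncₗ_mono, if_pos h2]
  · rw [truncₗ_mono, if_neg h2]
  · omega
  · exact map_zero _

/-! ### The relation `x_δ ^ (r - w) + Q` -/

variable (σ) in
/-- The monomials in `x_δ, …, x_n` of degree at least `k` in which the exponent of `x_δ` is less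
than `r - w`. -/
def tailSet (k : ℕ) : Set σ.Mon :=
  {m | m ∈ σ.monFrom σ.δ ∧ m (σ.idx σ.δ) < σ.r - σ.w ∧ k ≤ m.degree}

theorem mono_mul_mem_tailSet {k l : ℕ} {m : σ.Mon} (hm : m ∈ σ.monFrom σ.δ)
    (h0 : m (σ.idx σ.δ) = 0) (hl : l ≤ m.degree + k) {p : σ.Poly K}
    (hp : p ∈ restrictSupport _ (σ.tailSet k)) :
    σ.mono K m * p ∈ restrictSupport (σ.CoeffRing K) (σ.tailSet l) := by
  refine map_restrictSupport (f := LinearMap.mulLeft _ (σ.mono K m)) (fun t ht => ?_) hp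
  rw [LinearMap.mulLeft_apply, ← mono_add]
  refine mono_mem ⟨monFrom_add.2 ⟨hm, ht.1⟩, ?_, ?_⟩
  · rw [Finsupp.add_apply, h0, zero_add]
    exact ht.2.1
  · rw [map_add]
    exact hl.trans (Nat.add_le_add_left ht.2.2 _)

variable (σ K) in
/-- The quotient of the initial target by `x_{δ+1} ^ w`. -/
def relTail : σ.Poly K :=
  ∑ t : σ.tar'', C (σ.indTheta K t) * σ.mono K (t - σ.xpow (σ.δ + 1) σ.w)

variable (σ K) in
/-- The sum of `x_δ ^ (r - w)` and the quotient of the initial target by `x_{δ+1} ^ w`. -/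
def rel : σ.Poly K := σ.mono K (σ.xpow σ.δ (σ.r - σ.w)) + σ.relTail K

theorem initTarget_eq : σ.initTarget K = σ.mono K (σ.xpow (σ.δ + 1) σ.w) * σ.relTail K := by
  rw [initTarget, relTail, Finset.mul_sum]
  refine Finset.sum_congr rfl fun t _ => ?_
  rw [mul_left_comm, ← mono_add, add_tsub_cancel_of_le (mem_tar'' t.2).2.2.2.2]

/-- The lower bound `r - w` is the degree of the head `x_δ^(r-w)`, so rewriting by `rel` never
lowers degrees. The upper bound makes the initial target invariant under truncation. -/
theorem relTail_mem : σ.relTail K ∈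
    restrictSupport (σ.CoeffRing K)
      (σ.tailSet (σ.r - σ.w) ∩ {m | m.degree ≤ σ.s - 1 - σ.w}) := by
  refine Submodule.sum_mem _ fun t _ => ?_
  obtain ⟨hm, hr, hs, hd, hle⟩ := mem_tar'' t.2
  rw [← smul_eq_C_mul]
  refine Submodule.smul_mem _ _ (mono_mem ?_)
  have e := congrArg Finsupp.degree (tsub_add_cancel_of_le hle)
  rw [map_add, xpow, Finsupp.degree_single, ← xpow] at e
  have : (t.1 - σ.xpow (σ.δ + 1) σ.w) (σ.idx σ.δ) ≤ t.1 (σ.idx σ.δ) := tsub_le_self (a := t.1) _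
  refine ⟨⟨monFrom_of_le tsub_le_self hm, by omega, ?_⟩, ?_⟩
  · show _ ≤ (t.1 - σ.xpow (σ.δ + 1) σ.w).degree
    omega
  · show (t.1 - σ.xpow (σ.δ + 1) σ.w).degree ≤ _
    omega

theorem relTail_mem_tailSet :
    σ.relTail K ∈ restrictSupport (σ.CoeffRing K) (σ.tailSet (σ.r - σ.w)) :=
  restrictSupport_mono _ Set.inter_subset_left relTail_mem

variable (σ K) in
/-- Multiplication by `x_δ`, followed by the replacement of `x_δ ^ (r - w)` by means of the
relation `rel`. -/
def step : σ.Poly K →ₗ[σ.CoeffRing K] σ.Poly K :=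
  monomialLift _ fun t =>
    if t (σ.idx σ.δ) + 1 < σ.r - σ.w then σ.mono K (σ.xpow σ.δ 1 + t)
    else - (σ.mono K (t.erase (σ.idx σ.δ)) * σ.relTail K)

theorem step_mono (t : σ.Mon) : σ.step K (σ.mono K t) =
    if t (σ.idx σ.δ) + 1 < σ.r - σ.w then σ.mono K (σ.xpow σ.δ 1 + t)
    else - (σ.mono K (t.erase (σ.idx σ.δ)) * σ.relTail K) := by
  rw [step, mono, monomialLift_monomial]

theorem erase_front_mem {m : σ.Mon} (hm : m ∈ σ.monFrom σ.δ) :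
    m.erase (σ.idx σ.δ) ∈ σ.monFrom σ.δ :=
  (monFrom_add.1 (by rwa [Finsupp.single_add_erase])).2

/-- On `tailSet` the second branch of `step` occurs only for `x_δ`-exponent exactly `r - w - 1`, so
a single replacement restores normality. -/
theorem step_mem {k : ℕ} {p : σ.Poly K} (hp : p ∈ restrictSupport _ (σ.tailSet k)) :
    σ.step K p ∈ restrictSupport (σ.CoeffRing K) (σ.tailSet (k + 1)) := by
  refine map_restrictSupport (fun t ht => ?_) hp
  obtain ⟨hm, hd, hk⟩ := ht
  rw [step_mono]
  split_ifs with h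
  · refine mono_mem ⟨monFrom_add.2 ⟨xpow_mem_monFrom le_rfl σ.δ_lt_n.le, hm⟩, ?_, ?_⟩
    · rw [Finsupp.add_apply, xpow, Finsupp.single_eq_same]
      omega
    · rw [map_add, xpow, Finsupp.degree_single]
      omega
  · refine Submodule.neg_mem _ (mono_mul_mem_tailSet (erase_front_mem hm) Finsupp.erase_same ?_
      relTail_mem_tailSet)
    have := Finsupp.degree_erase_add t (σ.idx σ.δ)
    omega

theorem mul_sub_step_mem {k : ℕ} {p : σ.Poly K} (hp : p ∈ restrictSupport _ (σ.tailSet k)) :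
    σ.mono K (σ.xpow σ.δ 1) * p - σ.step K p ∈ Ideal.span {σ.rel K} := by
  refine map_restrictSupport (f := LinearMap.mulLeft _ (σ.mono K (σ.xpow σ.δ 1)) - σ.step K)
    (W := (Ideal.span {σ.rel K}).restrictScalars _) (fun t ht => ?_) hp
  obtain ⟨hm, hd, hk⟩ := ht
  rw [LinearMap.sub_apply, LinearMap.mulLeft_apply, step_mono, ← mono_add]
  split_ifs with h
  · rw [sub_self]
    exact Submodule.zero_mem _
  · rw [Submodule.restrictScalars_mem, Ideal.mem_span_singleton]
    refine ⟨σ.mono K (t.erase (σ.idx σ.δ)), ?_⟩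
    have e : σ.xpow σ.δ 1 + t = σ.xpow σ.δ (σ.r - σ.w) + t.erase (σ.idx σ.δ) := by
      conv_lhs => rw [← Finsupp.single_add_erase (σ.idx σ.δ) t]
      rw [← add_assoc, xpow, xpow, ← Finsupp.single_add]
      congr 2
      omega
    rw [e, mono_add, rel]
    ring

variable (σ K) in
/-- The element of `tailSet` congruent to `-x_δ ^ (r - w + u)` modulo `rel`. -/
def powTail (u : ℕ) : σ.Poly K := (σ.step K)^[u] (σ.relTail K)

theorem powTail_succ (u : ℕ) : σ.powTail K (u + 1) = σ.step K (σ.powTail K u) :=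
  Function.iterate_succ_apply' _ _ _

theorem powTail_mem (u : ℕ) : σ.powTail K u ∈
    restrictSupport (σ.CoeffRing K) (σ.tailSet (σ.r - σ.w + u)) := by
  induction u with
  | zero => exact relTail_mem_tailSet
  | succ u ih =>
    rw [powTail_succ]
    exact step_mem ih

theorem xpow_add_powTail_mem (u : ℕ) :
    σ.mono K (σ.xpow σ.δ (σ.r - σ.w + u)) + σ.powTail K u ∈ Ideal.span {σ.rel K} := by
  induction u with
  | zero => exact Ideal.subset_span rfl
  | succ u ih =>
    have h := Ideal.sub_mem _ (Ideal.mul_mem_left _ (σ.mono K (σ.xpow σ.δ 1)) ih)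
      (mul_sub_step_mem (powTail_mem u))
    rw [mul_add, ← mono_add, ← powTail_succ, add_sub_assoc, sub_sub_cancel] at h
    convert h using 3
    rw [xpow, xpow, xpow, ← Finsupp.single_add]
    congr 1
    omega

/-! ### Paths in a segment -/

/-- The divisions are exact because the power of `x` to be divided out is an explicit factor;
nothing is needed of `p`. -/
theorem iterate_divMonomial (x y m : σ.Mon) (p : σ.Poly K) (k : ℕ) :
    (fun Q => (σ.mono K y * Q).divMonomial x)^[k] (σ.mono K (m + k • x) * p) =
      σ.mono K (m + k • y) * p := by
  induction k generalizing m with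
  | zero => rw [Function.iterate_zero_apply, zero_nsmul, zero_nsmul]
  | succ k ih =>
    rw [Function.iterate_succ_apply]
    have e : (σ.mono K y * (σ.mono K (m + (k + 1) • x) * p)).divMonomial x =
        σ.mono K (m + y + k • x) * p := by
      rw [show σ.mono K y * (σ.mono K (m + (k + 1) • x) * p) =
        monomial x 1 * (σ.mono K (m + y + k • x) * p) by
          rw [← mono, ← mul_assoc, ← mul_assoc, ← mono_add, ← mono_add]
          congr 2
          rw [succ_nsmul]
          abel, divMonomial_monomial_mul]
    rw [e, ih, succ_nsmul, add_assoc, add_comm y]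

theorem expo_eq_add (m : σ.Mon) (q : ℕ) (hq : σ.δ + q < σ.n) :
    σ.expo m q = m ⟨σ.δ + q, hq⟩ + σ.expo m (q + 1) := by
  have e := Finset.sum_ite_eq' Finset.univ (⟨σ.δ + q, hq⟩ : Fin σ.n) m
  rw [if_pos (Finset.mem_univ _)] at e
  rw [expo, expo, ← e, ← Finset.sum_add_distrib]
  refine Finset.sum_congr rfl fun i _ => ?_
  simp only [Fin.ext_iff]
  split_ifs <;> omega

theorem expo_eq_zero (m : σ.Mon) {q : ℕ} (hq : σ.n ≤ σ.δ + q) : σ.expo m q = 0 :=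
  Finset.sum_eq_zero fun i _ => if_neg (by omega)

/-- The part of `m` in the variables `x_{δ+1}, …, x_{δ+q}`. -/
def middle (m : σ.Mon) (q : ℕ) : σ.Mon :=
  Finsupp.equivFunOnFinite.symm fun i : Fin σ.n =>
    if σ.δ ≤ (i : ℕ) ∧ (i : ℕ) < σ.δ + q then m i else 0

theorem middle_apply (m : σ.Mon) (q : ℕ) (i : Fin σ.n) :
    middle m q i = if σ.δ ≤ (i : ℕ) ∧ (i : ℕ) < σ.δ + q then m i else 0 := rfl

theorem middle_succ (m : σ.Mon) (q : ℕ) (hq : σ.δ + q < σ.n) :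
    middle m (q + 1) = middle m q + σ.xpow (σ.δ + q + 1) (m ⟨σ.δ + q, hq⟩) := by
  ext i
  rw [Finsupp.add_apply, middle_apply, middle_apply, xpow, Finsupp.single_apply]
  have h : σ.idx (σ.δ + q + 1) = i ↔ (i : ℕ) = σ.δ + q := by
    rw [Fin.ext_iff, σ.idx_val hq]
    omega
  rw [if_congr h rfl rfl]
  by_cases hi : (i : ℕ) = σ.δ + q
  · rw [show (⟨σ.δ + q, hq⟩ : Fin σ.n) = i from Fin.ext hi.symm]
    split_ifs <;> omega
  · split_ifs <;> omega

/-- Invariant of the path: after `q` stages the prefactor agrees with `m` in `x_{δ+1}, …, x_{δ+q}`,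
and the remaining degree `e_q` still sits on `x_{δ+q+1}`. -/
theorem alongPath_eq (m : σ.Mon) (p : σ.Poly K) (q : ℕ) (hq : σ.δ + q < σ.n) :
    σ.alongPath m (σ.mono K (σ.xpow (σ.δ + 1) (σ.expo m 0)) * p) q =
      σ.mono K (middle m q + σ.xpow (σ.δ + q + 1) (σ.expo m q)) * p := by
  induction q with
  | zero =>
    rw [alongPath, show middle m 0 = 0 by ext i; rw [middle_apply, if_neg (by omega)]; rfl,
      zero_add, add_zero]
  | succ q ih =>
    have hq' : σ.δ + q < σ.n := by omega
    have hx : ∀ k e : ℕ, σ.xpow k e = e • σ.xpow k 1 := fun k e => by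
      rw [xpow, xpow, Finsupp.smul_single, smul_eq_mul, mul_one]
    rw [alongPath, ih hq', expo_eq_add m q hq', show σ.xpow (σ.δ + q + 1)
      (m ⟨σ.δ + q, hq'⟩ + σ.expo m (q + 1)) = σ.xpow (σ.δ + q + 1) (m ⟨σ.δ + q, hq'⟩) +
        σ.expo m (q + 1) • σ.xpow (σ.δ + q + 1) 1 by rw [← hx, xpow, xpow, xpow,
          Finsupp.single_add], ← add_assoc, ← middle_succ, iterate_divMonomial, ← hx]
    rfl

theorem spread_eq {m : σ.Mon} (hm : m ∈ σ.monFrom σ.δ) (p : σ.Poly K) :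
    σ.spread m (σ.mono K (σ.xpow (σ.δ + 1) (σ.expo m 0)) * p) =
      σ.mono K (m.erase (σ.idx σ.δ)) * p := by
  have h1 := σ.one_le_δ
  have hn := σ.δ_lt_n
  rw [spread, alongPath_eq _ _ _ (by omega), expo_eq_add m _ (by omega),
    expo_eq_zero m (by omega), add_zero, ← middle_succ]
  congr 2
  ext i
  rw [middle_apply]
  rw [mem_monFrom_δ] at hm
  rcases lt_trichotomy i (σ.idx σ.δ) with h | rfl | h
  · rw [Finsupp.erase_ne h.ne, hm i h, ite_self]
  · rw [Finsupp.erase_same, if_neg]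
    rw [σ.idx_δ_val]
    omega
  · rw [Finsupp.erase_ne h.ne', if_pos]
    rw [Fin.lt_def, σ.idx_δ_val] at h
    omega

/-! ### The targets -/

/-- Only the product of `m'` with the back part of `b'` enters the target, and this is the back part
of `b`; hence the chosen factorization is irrelevant. -/
theorem targetD_eq {b : σ.Mon} (hb : b ∈ σ.setD) :
    σ.targetD K b = truncₗ σ.s (σ.mono K (b.erase (σ.idx σ.δ)) * σ.relTail K) := by
  have hw := σ.w_lt_r
  obtain ⟨hm, hr, hs, hd⟩ := mem_setD.1 hb
  have hex : ∃ f : σ.Mon × σ.Mon, f.1 ∈ σ.monFrom (σ.δ + 1) ∧ 1 ≤ f.1.degree ∧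
      f.1.degree ≤ σ.s - σ.r ∧ f.2 ∈ σ.seg σ.r σ.w ∧ b = f.1 + f.2 := by
    have hdeg := Finsupp.degree_erase_add b (σ.idx σ.δ)
    -- `c` becomes the back part of `b'`. It exists since the back part of `b` has degree `b.degree
    -- - (r - w) > w`.
    obtain ⟨c, hc, hcd⟩ := Finsupp.exists_le_degree_eq (b.erase (σ.idx σ.δ)) σ.w (by omega)
    have hc0 : c (σ.idx σ.δ) = 0 := Nat.le_zero.1 ((hc _).trans Finsupp.erase_same.le)
    have hcm := erase_front_mem hm
    have hsum := congrArg Finsupp.degree (tsub_add_cancel_of_le hc)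
    rw [map_add] at hsum
    refine ⟨⟨b.erase (σ.idx σ.δ) - c, Finsupp.single (σ.idx σ.δ) (b (σ.idx σ.δ)) + c⟩,
      mem_monFrom_succ.2 ⟨monFrom_of_le tsub_le_self hcm, ?_⟩, ?_, ?_,
      mem_seg_w.2 ⟨monFrom_add.2 ⟨xpow_mem_monFrom le_rfl σ.δ_lt_n.le, monFrom_of_le hc hcm⟩,
        ?_, ?_⟩, ?_⟩
    · rw [Finsupp.tsub_apply, Finsupp.erase_same, zero_tsub]
    · show 1 ≤ (b.erase (σ.idx σ.δ) - c).degree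
      omega
    · show (b.erase (σ.idx σ.δ) - c).degree ≤ _
      omega
    · rw [map_add, Finsupp.degree_single]
      omega
    · rw [Finsupp.add_apply, Finsupp.single_eq_same, hc0, hd, add_zero]
    · rw [add_left_comm, tsub_add_cancel_of_le hc, Finsupp.single_add_erase]
  have h : b ∈ σ.setD ∧ ∃ f : σ.Mon × σ.Mon, f.1 ∈ σ.monFrom (σ.δ + 1) ∧ 1 ≤ f.1.degree ∧
      f.1.degree ≤ σ.s - σ.r ∧ f.2 ∈ σ.seg σ.r σ.w ∧ b = f.1 + f.2 := ⟨hb, hex⟩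
  rw [targetD, dif_pos h, truncate_eq]
  obtain ⟨h1, -, -, h2, he⟩ := h.2.choose_spec
  generalize h.2.choose = f at *
  obtain ⟨h2m, h2r, h2d⟩ := mem_seg_w.1 h2
  have hw' : σ.expo f.2 0 = σ.w := by
    rw [expo_zero h2m]
    have := Finsupp.degree_erase_add f.2 (σ.idx σ.δ)
    omega
  have hsp := spread_eq h2m (σ.relTail K)
  rw [hw'] at hsp
  rw [initTarget_eq, hsp, ← mul_assoc, ← mono_add, he, Finsupp.erase_add,
    Finsupp.erase_of_notMem_support
      (f := f.1) (Finsupp.notMem_support_iff.2 (mem_monFrom_succ.1 h1).2)]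

theorem notMem_lead_of_mem_setD {b : σ.Mon} (hb : b ∈ σ.setD) : b ∉ σ.lead := by
  intro h
  have := (mem_lead.1 h).1
  have := (mem_setD.1 hb).2.1
  omega

/-- The reduction in Step 3 of the assignment is `step`, up to truncation. By `hlo` and `hjk`, when
`t` survives truncation the product with `x_δ` has degree in `r + 1, …, s`, so it lies in `O` or in
`S_D`, never among the leading monomials. -/
theorem reduceₗ_step_mono {j k : ℕ} (hjk : k + j + 1 = σ.s) {t : σ.Mon}
    (hm : t ∈ σ.monFrom σ.δ) (hd : t (σ.idx σ.δ) < σ.r - σ.w) (hlo : σ.r ≤ t.degree + j) :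
    Border.reduceₗ σ.ordIdeal (fun b => σ.genDist K b + σ.targetD K b)
      (σ.mono K (σ.xpow σ.δ 1) * (σ.mono K (σ.xpow (σ.δ + 1) j) * truncₗ k (σ.mono K t))) =
    σ.mono K (σ.xpow (σ.δ + 1) j) * truncₗ (k + 1) (σ.step K (σ.mono K t)) := by
  have hn := σ.δ_lt_n
  have hdx : ∀ i e, (σ.xpow i e).degree = e := fun i e => Finsupp.degree_single _ _
  rw [truncₗ_mono, step_mono]
  by_cases hk : t.degree ≤ k
  · rw [if_pos hk, ← mono_add, ← mono_add]
    have hfront : (σ.xpow σ.δ 1 + (σ.xpow (σ.δ + 1) j + t)) (σ.idx σ.δ) =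
        t (σ.idx σ.δ) + 1 := by
      rw [Finsupp.add_apply, Finsupp.add_apply, xpow, xpow, Finsupp.single_eq_same,
        Finsupp.single_eq_of_ne σ.idx_succ_ne.symm]
      omega
    have hfront' : (σ.xpow (σ.δ + 1) j + t) (σ.idx σ.δ) = t (σ.idx σ.δ) := by
      rw [Finsupp.add_apply, xpow, Finsupp.single_eq_of_ne σ.idx_succ_ne.symm, zero_add]
    have hmF' : σ.xpow (σ.δ + 1) j + t ∈ σ.monFrom σ.δ :=
      monFrom_add.2 ⟨xpow_mem_monFrom (Nat.le_succ _) hn, hm⟩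
    have hmF : σ.xpow σ.δ 1 + (σ.xpow (σ.δ + 1) j + t) ∈ σ.monFrom σ.δ :=
      monFrom_add.2 ⟨xpow_mem_monFrom le_rfl hn.le, hmF'⟩
    have hdeg' : (σ.xpow (σ.δ + 1) j + t).degree = j + t.degree := by rw [map_add, hdx]
    have hdeg : (σ.xpow σ.δ 1 + (σ.xpow (σ.δ + 1) j + t)).degree = 1 + (j + t.degree) := by
      rw [map_add, hdx, hdeg']
    have herase : (σ.xpow σ.δ 1 + (σ.xpow (σ.δ + 1) j + t)).erase (σ.idx σ.δ) =
        σ.xpow (σ.δ + 1) j + t.erase (σ.idx σ.δ) := by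
      rw [Finsupp.erase_add, Finsupp.erase_add, xpow, xpow, Finsupp.erase_single, zero_add,
        Finsupp.erase_single_ne σ.idx_succ_ne.symm]
    have hdt : (σ.xpow σ.δ 1 + t).degree ≤ k + 1 := by rw [map_add, hdx]; omega
    have hcomm : σ.xpow σ.δ 1 + (σ.xpow (σ.δ + 1) j + t) =
      σ.xpow (σ.δ + 1) j + (σ.xpow σ.δ 1 + t) := add_left_comm _ _ _
    by_cases h2 : t (σ.idx σ.δ) + 1 < σ.r - σ.w
    · have hO : σ.xpow σ.δ 1 + (σ.xpow (σ.δ + 1) j + t) ∈ σ.ordIdeal :=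
        mem_ordIdeal.2 (Or.inr ⟨by omega, by omega, hmF, by omega⟩)
      rw [if_pos h2, truncₗ_mono, if_pos hdt, ← mono_add, ← hcomm]
      exact (Border.reduceₗ_monomial _).trans (if_neg fun h => h.1 hO)
    · have hD : σ.xpow σ.δ 1 + (σ.xpow (σ.δ + 1) j + t) ∈ σ.setD :=
        mem_setD.2 ⟨hmF, by omega, by omega, by omega⟩
      refine (Border.reduceₗ_monomial _).trans ?_
      rw [if_pos hD.1, if_neg h2, genDist, dif_neg (notMem_lead_of_mem_setD hD), targetD_eq hD, ← mono,
        sub_add_cancel_left, map_neg]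
      refine Eq.trans (congrArg Neg.neg ?_) (mul_neg _ _).symm
      rw [herase, mono_add, mul_assoc, ← truncₗ_mono_mul, hdx, show j + (k + 1) = σ.s by omega]
  -- Since `step` raises degrees by at least 1, a term cut off at `k` before the step is cut off at
  -- `k + 1` after it.
  · rw [if_neg hk, mul_zero, mul_zero, map_zero]
    split_ifs with h
    · rw [truncₗ_mono, if_neg (by rw [map_add, hdx]; omega), mul_zero]
    · rw [map_neg, truncₗ_eq_zero, neg_zero, mul_zero]
      have := Finsupp.degree_erase_add t (σ.idx σ.δ)
      exact restrictSupport_mono _ (fun x hx => show k + 1 < x.degree from hx.2.2)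
        (mono_mul_mem_tailSet (l := k + 2) (erase_front_mem hm) Finsupp.erase_same (by omega)
          relTail_mem_tailSet)

theorem reduceₗ_step {j k lo : ℕ} (hjk : k + j + 1 = σ.s) (hlo : σ.r ≤ lo + j) {p : σ.Poly K}
    (hp : p ∈ restrictSupport _ (σ.tailSet lo)) :
    Border.reduceₗ σ.ordIdeal (fun b => σ.genDist K b + σ.targetD K b)
      (σ.mono K (σ.xpow σ.δ 1) * (σ.mono K (σ.xpow (σ.δ + 1) j) * truncₗ k p)) =
    σ.mono K (σ.xpow (σ.δ + 1) j) * truncₗ (k + 1) (σ.step K p) := by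
  have h := eqOn_restrictSupport (f := Border.reduceₗ σ.ordIdeal
      (fun b => σ.genDist K b + σ.targetD K b) ∘ₗ LinearMap.mulLeft _ (σ.mono K (σ.xpow σ.δ 1)) ∘ₗ
      LinearMap.mulLeft _ (σ.mono K (σ.xpow (σ.δ + 1) j)) ∘ₗ truncₗ k)
    (g := LinearMap.mulLeft _ (σ.mono K (σ.xpow (σ.δ + 1) j)) ∘ₗ truncₗ (k + 1) ∘ₗ σ.step K)
    (s := σ.tailSet lo) (fun t ht => ?_) hp
  · simpa only [LinearMap.comp_apply, LinearMap.mulLeft_apply] using h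
  · simp only [LinearMap.comp_apply, LinearMap.mulLeft_apply]
    exact reduceₗ_step_mono hjk ht.1 ht.2.1 (hlo.trans (Nat.add_le_add_right ht.2.2 _))

/-- The cutoff together with the prefactor always amounts to degree `s - 1`: the factor `x_δ` raises
it to `s`, where the reduction truncates, and division by `x_{δ+1}` brings it back. -/
theorem lexMaxTarget_eq (u : ℕ) (hu : u ≤ σ.w) : σ.lexMaxTarget K u =
    σ.mono K (σ.xpow (σ.δ + 1) (σ.w - u)) *
      truncₗ (σ.s - 1 - (σ.w - u)) (σ.powTail K u) := by
  have hw := σ.w_lt_r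
  have hs := σ.r_lt_s
  induction u with
  | zero =>
    rw [lexMaxTarget, initTarget_eq, Nat.sub_zero, powTail, Function.iterate_zero_apply,
      truncₗ_eq_self (restrictSupport_mono _ Set.inter_subset_right relTail_mem)]
  | succ u ih =>
    rw [lexMaxTarget, ih (by omega), Border.reduce_eq_reduceₗ,
      reduceₗ_step (by omega) (by omega) (powTail_mem u), ← powTail_succ,
      show σ.xpow (σ.δ + 1) (σ.w - u) = σ.xpow (σ.δ + 1) 1 + σ.xpow (σ.δ + 1) (σ.w - (u + 1)) by
        rw [xpow, xpow, xpow, ← Finsupp.single_add]; congr 1; omega,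
      mono_add, mul_assoc, show σ.mono K (σ.xpow (σ.δ + 1) 1) = monomial (σ.xpow (σ.δ + 1) 1) 1
        from rfl, divMonomial_monomial_mul]
    congr 3
    omega

theorem target_of_mem_setL {b : σ.Mon} (hb : b ∈ σ.setL) : σ.target K b =
    truncₗ (σ.s - 1) (σ.mono K (b.erase (σ.idx σ.δ)) *
      σ.powTail K (b (σ.idx σ.δ) - (σ.r - σ.w))) := by
  have hs := σ.r_lt_s
  have hw := σ.w_lt_r
  obtain ⟨hm, hr, hd⟩ := mem_setL.1 hb
  have hD : b ∉ σ.setD := fun h => by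
    have := (mem_setD.1 h).2.1
    omega
  have hdeg := Finsupp.degree_erase_add b (σ.idx σ.δ)
  have he := expo_zero hm
  rw [target, if_neg hD, if_pos hb, lexMaxTarget_eq _ (by omega),
    show σ.w - (σ.w - σ.expo b 0) = σ.expo b 0 by omega, spread_eq hm, ← truncₗ_mono_mul, ← he]
  rw [show σ.w - σ.expo b 0 = b (σ.idx σ.δ) - (σ.r - σ.w) by omega]
  congr 2
  omega

theorem mono_add_mem_span_rel {b : σ.Mon} (hb : σ.r - σ.w ≤ b (σ.idx σ.δ)) :
    σ.mono K b + σ.mono K (b.erase (σ.idx σ.δ)) *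
      σ.powTail K (b (σ.idx σ.δ) - (σ.r - σ.w)) ∈ Ideal.span {σ.rel K} := by
  have h := Ideal.mul_mem_left _ (σ.mono K (b.erase (σ.idx σ.δ)))
    (xpow_add_powTail_mem (K := K) (b (σ.idx σ.δ) - (σ.r - σ.w)))
  rwa [mul_add, ← mono_add, add_tsub_cancel_of_le hb, xpow, Finsupp.erase_add_single] at h

end DistSignature

end

/-! ### The ideal of the relation, and its normal forms -/

noncomputable section

namespace DistSignature

open MvPolynomial

variable {σ : DistSignature} {K : Type*} [Field K]

theorem coeff_eq_zero_of_mem {S : Set σ.Mon} {p : σ.Poly K} (hp : p ∈ restrictSupport _ S)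
    {m : σ.Mon} (hm : m ∉ S) : coeff m p = 0 :=
  notMem_support_iff.1 fun h => hm (hp h)

variable (σ) in
/-- The monomials that involve one of `x_1, …, x_{δ-1}` or have degree `> s`. -/
def killSet : Set σ.Mon := {m | ¬ (m ∈ σ.monFrom σ.δ ∧ m.degree ≤ σ.s)}

theorem isUpperSet_killSet : IsUpperSet σ.killSet := fun _ _ hle hm h =>
  hm ⟨monFrom_of_le hle h.1, (Finsupp.degree_mono hle).trans h.2⟩

variable (σ K) in
/-- The ideal generated by `rel` and the monomials in `killSet`. -/
def relIdeal : Ideal (σ.Poly K) :=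
  restrictSupportIdeal (σ.CoeffRing K) σ.killSet isUpperSet_killSet ⊔ Ideal.span {σ.rel K}

theorem mem_relIdeal_of_killSet {p : σ.Poly K} (hp : p ∈ restrictSupport _ σ.killSet) :
    p ∈ σ.relIdeal K :=
  Ideal.mem_sup_left hp

theorem mem_relIdeal_of_degree {p : σ.Poly K}
    (hp : p ∈ restrictSupport _ {m | σ.s + 1 ≤ m.degree}) : p ∈ σ.relIdeal K := by
  refine mem_relIdeal_of_killSet (restrictSupport_mono _ ?_ hp)
  intro m (hm : σ.s + 1 ≤ m.degree) h
  have := h.2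
  omega

theorem add_truncₗ_mem_relIdeal {p q : σ.Poly K} (h : p + q ∈ Ideal.span {σ.rel K}) :
    p + truncₗ σ.s q ∈ σ.relIdeal K := by
  have hq := sub_truncₗ_mem (S := Set.univ) σ.s (p := q) (by simp)
  have h' := Ideal.sub_mem (σ.relIdeal K) (Ideal.mem_sup_right h)
    (mem_relIdeal_of_degree (restrictSupport_mono _ Set.inter_subset_right hq))
  rwa [add_sub_assoc, sub_sub_cancel] at h'

theorem rel_mem : σ.rel K ∈ restrictSupport (σ.CoeffRing K)
    {m | m ∈ σ.monFrom σ.δ ∧ σ.r - σ.w ≤ m.degree} := by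
  have h : σ.xpow σ.δ (σ.r - σ.w) ∈ {m | m ∈ σ.monFrom σ.δ ∧ σ.r - σ.w ≤ m.degree} :=
    ⟨xpow_mem_monFrom le_rfl σ.δ_lt_n.le, (Finsupp.degree_single _ _).ge⟩
  have h' : σ.tailSet (σ.r - σ.w) ⊆ {m | m ∈ σ.monFrom σ.δ ∧ σ.r - σ.w ≤ m.degree} :=
    fun m hm => ⟨hm.1, hm.2.2⟩
  exact Submodule.add_mem _ (mono_mem h) (restrictSupport_mono _ h' relTail_mem_tailSet)

/-- Write `p = z + rel * g`. As `rel` is monic in `x_δ`, the coefficients of `g` that can influence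
degrees up to `s` vanish, by induction on the degree in the back variables. -/
theorem eq_zero_of_mem_relIdeal {p : σ.Poly K} (hp : p ∈ σ.relIdeal K)
    (hO : p ∈ restrictSupport _ (σ.tailSet 0 ∩ {m | m.degree ≤ σ.s})) : p = 0 := by
  obtain ⟨z, hz, y, hy, rfl⟩ := Submodule.mem_sup.1 hp
  obtain ⟨g, rfl⟩ := Ideal.mem_span_singleton.1 hy
  have hz0 : ∀ m ∈ σ.monFrom σ.δ, m.degree ≤ σ.s → coeff m z = 0 := fun m hm hd =>
    coeff_eq_zero_of_mem (S := σ.killSet) hz fun h => h ⟨hm, hd⟩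
  have hg : ∀ N : ℕ, ∀ m : σ.Mon, m ∈ σ.monFrom σ.δ → (m.erase (σ.idx σ.δ)).degree = N →
      m.degree + (σ.r - σ.w) ≤ σ.s → coeff m g = 0 := by
    intro N
    induction N using Nat.strong_induction_on with
    | _ N ih =>
      intro m hm hN hd
      have hxm : σ.xpow σ.δ (σ.r - σ.w) + m ∈ σ.monFrom σ.δ :=
        monFrom_add.2 ⟨xpow_mem_monFrom le_rfl σ.δ_lt_n.le, hm⟩
      have h0 : coeff (σ.xpow σ.δ (σ.r - σ.w) + m) (z + σ.rel K * g) = 0 := by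
        refine coeff_eq_zero_of_mem hO fun h => ?_
        have := h.1.2.1
        rw [Finsupp.add_apply, xpow, Finsupp.single_eq_same] at this
        omega
      have h1 : coeff (σ.xpow σ.δ (σ.r - σ.w) + m) (σ.relTail K * g) = 0 := by
        rw [coeff_mul]
        refine Finset.sum_eq_zero fun tv htv => ?_
        rw [Finset.HasAntidiagonal.mem_antidiagonal] at htv
        -- A tail term has `x_δ`-exponent below `r - w` but degree at least `r - w`. So the cofactor
        -- `tv.2` has larger `x_δ`-exponent than `m` and no larger degree, hence smaller back
        -- degree.
        by_cases ht : tv.1 ∈ σ.tailSet (σ.r - σ.w)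
        · rw [ih (tv.2.erase (σ.idx σ.δ)).degree ?_ tv.2 ?_ rfl ?_, mul_zero]
          · have e1 := Finsupp.degree_erase_add m (σ.idx σ.δ)
            have e2 := Finsupp.degree_erase_add tv.2 (σ.idx σ.δ)
            have e3 := congrArg Finsupp.degree htv
            have e4 := DFunLike.congr_fun htv (σ.idx σ.δ)
            rw [Finsupp.add_apply, Finsupp.add_apply, xpow, Finsupp.single_eq_same] at e4
            rw [map_add, map_add, xpow, Finsupp.degree_single] at e3
            have := ht.2.1
            have := ht.2.2
            omega
          · exact (monFrom_add.1 (htv ▸ hxm)).2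
          · have e3 := congrArg Finsupp.degree htv
            rw [map_add, map_add, xpow, Finsupp.degree_single] at e3
            have := ht.2.2
            omega
        · rw [coeff_eq_zero_of_mem relTail_mem_tailSet ht, zero_mul]
      rw [coeff_add, hz0 _ hxm (by rw [map_add, xpow, Finsupp.degree_single]; omega), zero_add,
        rel, add_mul, coeff_add, h1, add_zero, mono, coeff_monomial_mul, one_mul] at h0
      exact h0
  refine MvPolynomial.ext _ _ fun m => ?_
  rw [coeff_zero]
  by_cases hm : m ∈ σ.tailSet 0 ∩ {m | m.degree ≤ σ.s}
  · have hms : m.degree ≤ σ.s := hm.2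
    rw [coeff_add, hz0 m hm.1.1 hms, zero_add, coeff_mul]
    refine Finset.sum_eq_zero fun tv htv => ?_
    rw [Finset.HasAntidiagonal.mem_antidiagonal] at htv
    by_cases ht : tv.1 ∈ {m : σ.Mon | m ∈ σ.monFrom σ.δ ∧ σ.r - σ.w ≤ m.degree}
    · rw [hg _ tv.2 (monFrom_add.1 (htv ▸ hm.1.1)).2 rfl, mul_zero]
      rw [← htv, map_add] at hms
      have := ht.2
      omega
    · rw [coeff_eq_zero_of_mem rel_mem ht, zero_mul]
  · exact coeff_eq_zero_of_mem hO hm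

/-! ### Twisting by trailing monomials -/

open scoped Classical in
/-- The linear map that sends each leading monomial `b` to `T b` and all other monomials to `0`. -/
def twist (T : σ.Mon → σ.Poly K) : σ.Poly K →ₗ[σ.CoeffRing K] σ.Poly K :=
  monomialLift _ fun m => if m ∈ σ.lead then T m else 0

open scoped Classical in
theorem twist_mono (T : σ.Mon → σ.Poly K) (m : σ.Mon) :
    twist T (σ.mono K m) = if m ∈ σ.lead then T m else 0 :=
  monomialLift_monomial _ m

theorem twist_eq_zero (T : σ.Mon → σ.Poly K) {p : σ.Poly K}
    (hp : p ∈ restrictSupport _ {m | m ∉ σ.lead}) : twist T p = 0 :=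
  eqOn_restrictSupport (g := 0) (fun m hm => (twist_mono T m).trans (if_neg hm)) hp

theorem twist_eq_zero_of_degree (T : σ.Mon → σ.Poly K) {p : σ.Poly K}
    (hp : p ∈ restrictSupport _ {m | σ.r + 1 ≤ m.degree}) : twist T p = 0 := by
  refine twist_eq_zero T (restrictSupport_mono _ ?_ hp)
  intro m (hm : σ.r + 1 ≤ m.degree) h
  have := (mem_lead.1 h).1
  omega

theorem twist_mem {T : σ.Mon → σ.Poly K} (hT : ∀ b, T b ∈ restrictSupport _ σ.trail)
    (p : σ.Poly K) : twist T p ∈ restrictSupport (σ.CoeffRing K) σ.trail := by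
  refine map_restrictSupport (S := Set.univ) (fun m _ => ?_) (by simp)
  rw [twist_mono]
  split_ifs
  · exact hT m
  · exact Submodule.zero_mem _

theorem X_mul_mem_of_degree {k : ℕ} (i : Fin σ.n) {p : σ.Poly K}
    (hp : p ∈ restrictSupport _ {m | k ≤ m.degree}) :
    X i * p ∈ restrictSupport (σ.CoeffRing K) {m | k + 1 ≤ m.degree} := by
  refine map_restrictSupport (f := LinearMap.mulLeft _ (X i)) (fun m hm => ?_) hp
  rw [LinearMap.mulLeft_apply, show (X i : σ.Poly K) = σ.mono K (Finsupp.single i 1) from rfl,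
    ← mono_add]
  refine mono_mem ?_
  rw [Set.mem_ofPred_eq, map_add, Finsupp.degree_single, add_comm]
  exact Nat.add_le_add_left hm 1

/-- `X i * p` has no term of degree `r`, so its twist is 0, while `X i * twist T p` has degree above
`s` and lies in `relIdeal`. -/
theorem X_mul_add_twist_mem {T : σ.Mon → σ.Poly K}
    (hT : ∀ b, T b ∈ restrictSupport _ σ.trail) (i : Fin σ.n) {p : σ.Poly K}
    (hr : p ∈ restrictSupport _ {m | σ.r ≤ m.degree}) (hp : p + twist T p ∈ σ.relIdeal K) :
    X i * p + twist T (X i * p) ∈ σ.relIdeal K := by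
  have h : σ.trail ⊆ {m | σ.s ≤ m.degree} := fun m hm => hm.2.ge
  have h1 := X_mul_mem_of_degree i (restrictSupport_mono _ h (twist_mem hT p))
  have h2 := Ideal.sub_mem _ (Ideal.mul_mem_left _ (X i) hp) (mem_relIdeal_of_degree h1)
  rwa [twist_eq_zero_of_degree T (X_mul_mem_of_degree i hr), add_zero, ← add_sub_cancel_right
    (X i * p) (X i * twist T p), ← mul_add]

/-- The ideal of those `p`, with all terms of degree `≥ r`, for which `p + twist T p` lies in
`relIdeal`. -/
def twistIdeal (T : σ.Mon → σ.Poly K) (hT : ∀ b, T b ∈ restrictSupport _ σ.trail) :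
    Ideal (σ.Poly K) where
  carrier := {p | p ∈ restrictSupport _ {m | σ.r ≤ m.degree} ∧ p + twist T p ∈ σ.relIdeal K}
  zero_mem' := ⟨Submodule.zero_mem _, by rw [map_zero, add_zero]; exact Ideal.zero_mem _⟩
  add_mem' := fun {p q} hp hq => ⟨Submodule.add_mem _ hp.1 hq.1, by
    rw [map_add, add_add_add_comm]
    exact Ideal.add_mem _ hp.2 hq.2⟩
  smul_mem' := by
    intro c p hp
    rw [smul_eq_mul]
    induction c using MvPolynomial.induction_on with
    | C a =>
      rw [← smul_eq_C_mul]
      refine ⟨Submodule.smul_mem _ _ hp.1, ?_⟩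
      rw [map_smul, ← smul_add, smul_eq_C_mul]
      exact Ideal.mul_mem_left _ _ hp.2
    | add c d hc hd =>
      rw [add_mul]
      refine ⟨Submodule.add_mem _ hc.1 hd.1, ?_⟩
      rw [map_add, add_add_add_comm]
      exact Ideal.add_mem _ hc.2 hd.2
    | mul_X c i hc =>
      rw [mul_right_comm, mul_comm]
      have h : {m : σ.Mon | σ.r + 1 ≤ m.degree} ⊆ {m | σ.r ≤ m.degree} :=
        fun m hm => (Nat.le_succ _).trans hm
      exact ⟨restrictSupport_mono _ h (X_mul_mem_of_degree i hc.1),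
        X_mul_add_twist_mem hT i hc.1 hc.2⟩

theorem tailSet_inter_subset {k : ℕ} :
    σ.tailSet k ∩ {m | m.degree ≤ σ.s} ⊆ σ.ordIdeal := fun m hm => by
  rw [mem_ordIdeal]
  rcases lt_or_ge m.degree σ.r with h | h
  · exact Or.inl h
  · exact Or.inr ⟨h, hm.2, hm.1.1, hm.1.2.1⟩

theorem mem_tailSet_of_mem_ordIdeal {m : σ.Mon} (hm : m ∈ σ.ordIdeal) (hr : σ.r ≤ m.degree) :
    m ∈ σ.tailSet σ.r ∩ {m | m.degree ≤ σ.s} := by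
  rcases mem_ordIdeal.1 hm with h | ⟨h1, h2, h3, h4⟩
  · omega
  · exact ⟨⟨h3, h4, h1⟩, h2⟩

theorem trail_subset : σ.trail ⊆ σ.tailSet σ.r ∩ {m | m.degree ≤ σ.s} := fun _ hm =>
  mem_tailSet_of_mem_ordIdeal hm.1 (σ.r_lt_s.le.trans hm.2.ge)

theorem tailSet_mono {k l : ℕ} (h : k ≤ l) : σ.tailSet l ⊆ σ.tailSet k := fun _ hm =>
  ⟨hm.1, hm.2.1, h.trans hm.2.2⟩

theorem notMem_lead_of_mem_ordIdeal {m : σ.Mon} (hm : m ∈ σ.ordIdeal) : m ∉ σ.lead := fun h =>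
  (mem_lead.1 h).2 hm

/-- The twist vanishes on the span of `O`, which contains no leading monomial. The bound on degrees
from below excludes those elements of `O` that are not normal modulo `rel`. -/
theorem eq_zero_of_mem_twistIdeal {T : σ.Mon → σ.Poly K}
    {hT : ∀ b, T b ∈ restrictSupport _ σ.trail} {p : σ.Poly K} (hp : p ∈ twistIdeal T hT)
    (hO : p ∈ restrictSupport _ σ.ordIdeal) : p = 0 := by
  obtain ⟨hr, hp⟩ := hp
  rw [twist_eq_zero T (restrictSupport_mono _ (fun m hm => notMem_lead_of_mem_ordIdeal hm) hO),
    add_zero] at hp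
  refine eq_zero_of_mem_relIdeal hp fun m hm => ?_
  have h := mem_tailSet_of_mem_ordIdeal (hO hm) (hr hm)
  exact ⟨tailSet_mono (Nat.zero_le _) h.1, h.2⟩

/-! ### The generic modification -/

theorem target_mem (b : σ.Mon) : σ.target K b ∈
    restrictSupport (σ.CoeffRing K) (σ.tailSet σ.r ∩ {m | m.degree ≤ σ.s}) := by
  have hw := σ.w_lt_r
  have hdeg := Finsupp.degree_erase_add b (σ.idx σ.δ)
  by_cases hD : b ∈ σ.setD
  · rw [target, if_pos hD, targetD_eq hD]
    obtain ⟨hm, hr, -, hd⟩ := mem_setD.1 hD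
    exact truncₗ_mem _ (mono_mul_mem_tailSet (erase_front_mem hm) Finsupp.erase_same
      (by omega) relTail_mem_tailSet)
  by_cases hL : b ∈ σ.setL
  · rw [target_of_mem_setL hL]
    obtain ⟨hm, hr, hd⟩ := mem_setL.1 hL
    exact restrictSupport_mono _ (Set.inter_subset_inter_right _
        fun m (hm : m.degree ≤ σ.s - 1) => hm.trans (Nat.sub_le _ _))
      (truncₗ_mem _ (mono_mul_mem_tailSet (erase_front_mem hm) Finsupp.erase_same
        (by omega) (powTail_mem _)))
  · rw [target, if_neg hD, if_neg hL]
    exact Submodule.zero_mem _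

variable (K) in
open scoped Classical in
/-- The sum of trailing terms that is subtracted from `b` in the generic distinguished
pre-basis. -/
def leadTail (b : σ.Mon) : σ.Poly K :=
  if h : b ∈ σ.lead then ∑ t : σ.trail, C (σ.indC K ⟨b, h⟩ t) * σ.mono K t else 0

theorem leadTail_mem (b : σ.Mon) :
    leadTail K b ∈ restrictSupport (σ.CoeffRing K) σ.trail := by
  rw [leadTail]
  split_ifs
  · refine Submodule.sum_mem _ fun t _ => ?_
    rw [← smul_eq_C_mul]
    exact Submodule.smul_mem _ _ (mono_mem t.2)
  · exact Submodule.zero_mem _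

theorem genMod_eq (b : σ.Mon) :
    σ.genMod K b = σ.mono K b - leadTail K b + σ.target K b := by
  rw [genMod, genDist, leadTail]
  split_ifs
  · rfl
  · rw [sub_zero]

theorem genMod_sub_mem (b : σ.Mon) : σ.genMod K b - σ.mono K b ∈
    restrictSupport (σ.CoeffRing K) (σ.tailSet σ.r ∩ {m | m.degree ≤ σ.s}) := by
  rw [genMod_eq, show σ.mono K b - leadTail K b + σ.target K b - σ.mono K b =
    σ.target K b - leadTail K b by ring]
  exact Submodule.sub_mem _ (target_mem b) (restrictSupport_mono _ trail_subset (leadTail_mem b))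

theorem isPrebasis_genMod : Border.IsPrebasis σ.ordIdeal (σ.genMod K) := fun b _ _ hm =>
  tailSet_inter_subset (genMod_sub_mem b hm)

/-- On `S_D` the target is the normal form truncated at degree `s`, harmless modulo `relIdeal`;
every other nonleading boundary monomial is itself killed. -/
theorem genMod_mem_relIdeal {b : σ.Mon} (hb : b ∈ σ.bdry) (hl : b ∉ σ.lead) :
    σ.genMod K b ∈ σ.relIdeal K := by
  rw [genMod_eq, leadTail, dif_neg hl, sub_zero]
  by_cases hD : b ∈ σ.setD
  · rw [target, if_pos hD, targetD_eq hD]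
    refine add_truncₗ_mem_relIdeal ?_
    have h := mono_add_mem_span_rel (K := K) (mem_setD.1 hD).2.2.2.ge
    rwa [(mem_setD.1 hD).2.2.2, Nat.sub_self] at h
  · rw [target, if_neg hD, if_neg fun h => hl h.1, add_zero]
    refine mem_relIdeal_of_killSet (mono_mem fun h => hD ⟨hb, h.1, ?_, h.2⟩)
    have h1 := (degree_of_mem_bdry hb).1
    have h2 : b.degree ≠ σ.r := fun h => hl (mem_lead.2 ⟨h, hb.1⟩)
    omega

theorem exists_genMod_add_mem_relIdeal {b : σ.Mon} (hb : b ∈ σ.lead) :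
    ∃ T ∈ restrictSupport (σ.CoeffRing K) σ.trail, σ.genMod K b + T ∈ σ.relIdeal K := by
  have hs := σ.r_lt_s
  have hw := σ.w_lt_r
  by_cases hm : b ∈ σ.monFrom σ.δ
  · have hL : b ∈ σ.setL := ⟨hb, hm⟩
    obtain ⟨-, hr, hd⟩ := mem_setL.1 hL
    have hdeg := Finsupp.degree_erase_add b (σ.idx σ.δ)
    set Y := σ.mono K (b.erase (σ.idx σ.δ)) *
      σ.powTail K (b (σ.idx σ.δ) - (σ.r - σ.w)) with hYdef
    have hY : Y ∈ restrictSupport _ (σ.tailSet σ.r) :=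
      mono_mul_mem_tailSet (erase_front_mem hm) Finsupp.erase_same (by omega) (powTail_mem _)
    -- The correction cancels the `C_{t,b}` terms and supplies the degree `s` part of the normal
    -- form, which the target lacks.
    refine ⟨leadTail K b + (truncₗ σ.s Y - truncₗ (σ.s - 1) Y), ?_, ?_⟩
    · refine Submodule.add_mem _ (leadTail_mem b) ?_
      rw [← truncₗ_truncₗ (Nat.sub_le σ.s 1)]
      refine restrictSupport_mono _ ?_ (sub_truncₗ_mem (σ.s - 1) (truncₗ_mem σ.s hY))
      refine fun m hm => ⟨tailSet_inter_subset hm.1, ?_⟩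
      have h1 : m.degree ≤ σ.s := hm.1.2
      have h2 : σ.s - 1 < m.degree := hm.2
      omega
    · rw [genMod_eq, target_of_mem_setL hL, ← hYdef, show ∀ x y u v : σ.Poly K,
        x - y + u + (y + (v - u)) = x + v from fun x y u v => by ring]
      exact add_truncₗ_mem_relIdeal (mono_add_mem_span_rel hd)
  · refine ⟨leadTail K b, leadTail_mem b, ?_⟩
    rw [genMod_eq, target, if_neg fun h => notMem_lead_of_mem_setD h hb, if_neg fun h => hm h.2,
      add_zero, sub_add_cancel]
    exact mem_relIdeal_of_killSet (mono_mem fun h => hm h.1)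

variable (σ K) in
theorem exists_ideal : ∃ I : Ideal (σ.Poly K), (∀ b ∈ σ.bdry, σ.genMod K b ∈ I) ∧
    ∀ p ∈ I, p ∈ restrictSupport (σ.CoeffRing K) σ.ordIdeal → p = 0 := by
  have hex : ∀ b : σ.Mon, ∃ T ∈ restrictSupport (σ.CoeffRing K) σ.trail,
      b ∈ σ.lead → σ.genMod K b + T ∈ σ.relIdeal K := fun b => by
    by_cases hb : b ∈ σ.lead
    · obtain ⟨T, hT, h⟩ := exists_genMod_add_mem_relIdeal (K := K) hb
      exact ⟨T, hT, fun _ => h⟩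
    · exact ⟨0, Submodule.zero_mem _, fun h => absurd h hb⟩
  choose T hT hTb using hex
  have hr : σ.tailSet σ.r ∩ {m | m.degree ≤ σ.s} ⊆ {m | σ.r ≤ m.degree} := fun m hm => hm.1.2.2
  refine ⟨twistIdeal T hT, fun b hb => ⟨?_, ?_⟩, fun p hp hO => eq_zero_of_mem_twistIdeal hp hO⟩
  · rw [← sub_add_cancel (σ.genMod K b) (σ.mono K b)]
    exact Submodule.add_mem _ (restrictSupport_mono _ hr (genMod_sub_mem b))
      (mono_mem (degree_of_mem_bdry hb).1)
  -- Only the head `b` can be a leading monomial, so the twist adds precisely `T b` or nothing.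
  · have h : twist T (σ.genMod K b) = twist T (σ.mono K b) := by
      rw [← sub_eq_zero, ← map_sub]
      exact twist_eq_zero T (restrictSupport_mono _
        (fun m hm => notMem_lead_of_mem_ordIdeal (tailSet_inter_subset hm)) (genMod_sub_mem b))
    rw [h, twist_mono]
    split_ifs with hl
    · exact hTb b hl
    · rw [add_zero]
      exact genMod_mem_relIdeal hb hl

end DistSignature

end

/-! ### The main theorem -/

theorem mainTheorem1 (K : Type*) [Field K] (σ : DistSignature) :
    -- S-polynomials of next-door neighbor pairs
    (∀ b₁ ∈ σ.bdry, ∀ b₂ ∈ σ.bdry, ∀ α : Fin σ.n,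
      b₁ + Finsupp.single α 1 = b₂ →
        Border.ReducesTo σ.ordIdeal (σ.genMod K)
          (MvPolynomial.X α * σ.genMod K b₁ - σ.genMod K b₂) 0) ∧
    -- S-polynomials of across-the-street neighbor pairs
    (∀ b₁ ∈ σ.bdry, ∀ b₂ ∈ σ.bdry, ∀ α β : Fin σ.n, α ≠ β →
      b₁ + Finsupp.single α 1 = b₂ + Finsupp.single β 1 →
        Border.ReducesTo σ.ordIdeal (σ.genMod K)
          (MvPolynomial.X α * σ.genMod K b₁ - MvPolynomial.X β * σ.genMod K b₂) 0) ∧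
    -- freeness of the quotient, with basis the order ideal
    Border.IsFreeWithBasis σ.ordIdeal (σ.genMod K) ∧
    -- the generic modification is a border basis
    Border.IsBasis σ.ordIdeal (σ.genMod K) := by
  obtain ⟨I, hI, hO⟩ := σ.exists_ideal K
  have hg := DistSignature.isPrebasis_genMod (σ := σ) (K := K)
  have h0 : (0 : σ.Mon) ∈ σ.ordIdeal := by
    have := σ.two_le_r
    refine Or.inl ?_
    rw [map_zero]
    omega
  have hfree := Border.isFreeWithBasis hg h0 hI hO
  exact ⟨fun b₁ h₁ b₂ h₂ α h => Border.reducesTo_nextDoor hg hI hO h₁ h₂ α h,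
    fun b₁ h₁ b₂ h₂ α β _ h => Border.reducesTo_acrossStreet hg hI hO h₁ h₂ α β h,
    hfree, hg, hfree⟩
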